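/- Let $\mathcal S=\{1,\dots,S\}$ and $\mathcal A=\{1,\dots,A\}$ with $S,A\ge 1$, and write $\Delta_n$ for the probability simplex in $\mathbb R^n$. Consider rewards $r_{sas'}\ge 0$, a discount factor $\lambda\in(0,1)$, nominal transition probabilities $\overline{\boldsymbol p}_{sa}\in\Delta_S$ with $\overline p_{sas'}>0$, and a budget $\kappa\ge 0$. Let $\phi(t)=|t-1|$ (variation distance) or $\phi(t)=(t-1)^2$ ($\chi^2$-distance), and define the $s$-rectangular ambiguity sets $$\mathcal P_s=\Big\{\boldsymbol p_s\in(\Delta_S)^A:\ \sum_{a\in\mathcal A}\sum_{s'\in\mathcal S}\overline p_{sas'}\,\phi\big(p_{sas'}/\overline p_{sas'}\big)\le\kappa\Big\},$$ the robust Bellman operator $$[\mathfrak J(\boldsymbol v)]_s=\max_{\boldsymbol\pi_s\in\Delta_A}\ \min_{\boldsymbol p_s\in\mathcal P_s}\ \sum_{a\in\mathcal A}\pi_{sa}\,\boldsymbol p_{sa}^\top(\boldsymbol r_{sa}+\lambda\boldsymbol v),\qquad s\in\mathcal S,$$ and $\overline R=(1-\lambda)^{-1}\max_{s,a,s'} r_{sas'}$.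 For each of the two choices of $\phi$ there are a single program of a real random access machine (arithmetic and comparisons of real numbers, and additions, subtractions, comparisons and array indexing with natural numbers, each take unit time) and a constant $C>0$ such that for all $S,A\ge1$, all $\boldsymbol r,\lambda,\overline{\boldsymbol p},\kappa$ as above, all $\boldsymbol v\in\mathbb R^S$ with $\lVert\boldsymbol r_{sa}+\lambda\boldsymbol v\rVert_\infty\le\overline R$ for all $s,a$ (in particular whenever $\boldsymbol 0\le\boldsymbol v\le\overline R\,\mathbf e$), and all $\epsilon>0$, the program, given $S,A,\epsilon,\kappa,\lambda,\boldsymbol v,\overline{\boldsymbol p},\boldsymbol r$ as input, halts with an output $\boldsymbol v'\in\mathbb R^S$ satisfying $\lVert\boldsymbol v'-\mathfrak J(\boldsymbol v)\rVert_\infty\le\epsilon$ after at most $$C\cdot S^2\,(1+\log S)\cdot A\cdot\big(1+\max\{0,\log[\overline R/\epsilon]\}\big)$$ steps. In particular, for $S\ge 2$ and $\epsilon\le\overline R/2$ the running time is $\mathcal O(S^2\log S\cdot A\cdot\log[\overline R/\epsilon])$, with an absolute constant. -/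

import Mathlib

open scoped BigOperators

noncomputable section

/-! ## A real random access machine

Exact real arithmetic and comparisons, and index arithmetic on natural numbers, at unit cost.
A program is one finite text; it addresses its registers and its arrays by fixed names, and the cells
of an array by the content of a natural-number register. There is no rounding, no passage from
reals to naturals, and no multiplication of naturals. -/

namespace RealRAM

/-- A state: natural-number and real registers, and natural-number and real arrays
(`nArr k i` is cell `i` of array `k`). -/
structure State where
  nReg : ℕ → ℕ
  rReg : ℕ → ℝ
  nArr : ℕ → ℕ → ℕ
  rArr : ℕ → ℕ → ℝ

/-- The elementary instructions; the first argument names the target. -/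
inductive Instr where
  | nConst (i c : ℕ)
  | nMove (i j : ℕ)
  | nAdd (i j k : ℕ)
  | nSub (i j k : ℕ)
  | rConst (i : ℕ) (q : ℚ)
  | rMove (i j : ℕ)
  | rAdd (i j k : ℕ)
  | rSub (i j k : ℕ)
  | rMul (i j k : ℕ)
  | rDiv (i j k : ℕ)
  | nLoad (i arr idx : ℕ)
  | nStore (arr idx j : ℕ)
  | rLoad (i arr idx : ℕ)
  | rStore (arr idx j : ℕ)

/-- Overwrite cell `i` of array `k` by `x`. -/
def updateArr {α : Type} (m : ℕ → ℕ → α) (k i : ℕ) (x : α) : ℕ → ℕ → α :=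
  Function.update m k (Function.update (m k) i x)

/-- The effect of an instruction. Subtraction of naturals is truncated, and division of reals
by zero gives zero. -/
def Instr.apply : Instr → State → State
  | .nConst i c, σ => { σ with nReg := Function.update σ.nReg i c }
  | .nMove i j, σ => { σ with nReg := Function.update σ.nReg i (σ.nReg j) }
  | .nAdd i j k, σ => { σ with nReg := Function.update σ.nReg i (σ.nReg j + σ.nReg k) }
  | .nSub i j k, σ => { σ with nReg := Function.update σ.nReg i (σ.nReg j - σ.nReg k) }
  | .rConst i q, σ => { σ with rReg := Function.update σ.rReg i (q : ℝ) }
  | .rMove i j, σ => { σ with rReg := Function.update σ.rReg i (σ.rReg j) }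
  | .rAdd i j k, σ => { σ with rReg := Function.update σ.rReg i (σ.rReg j + σ.rReg k) }
  | .rSub i j k, σ => { σ with rReg := Function.update σ.rReg i (σ.rReg j - σ.rReg k) }
  | .rMul i j k, σ => { σ with rReg := Function.update σ.rReg i (σ.rReg j * σ.rReg k) }
  | .rDiv i j k, σ => { σ with rReg := Function.update σ.rReg i (σ.rReg j / σ.rReg k) }
  | .nLoad i arr idx, σ =>
      { σ with nReg := Function.update σ.nReg i (σ.nArr arr (σ.nReg idx)) }
  | .nStore arr idx j, σ =>
      { σ with nArr := updateArr σ.nArr arr (σ.nReg idx) (σ.nReg j) }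
  | .rLoad i arr idx, σ =>
      { σ with rReg := Function.update σ.rReg i (σ.rArr arr (σ.nReg idx)) }
  | .rStore arr idx j, σ =>
      { σ with rArr := updateArr σ.rArr arr (σ.nReg idx) (σ.rReg j) }

/-- The elementary tests: strict comparison of two registers of the same kind. -/
inductive Test where
  | nLt (i j : ℕ)
  | rLt (i j : ℕ)

/-- The test succeeds in the given state. -/
def Test.Holds : Test → State → Prop
  | .nLt i j, σ => σ.nReg i < σ.nReg j
  | .rLt i j, σ => σ.rReg i < σ.rReg j

/-- Structured programs. `loop c P` repeats `P` while the test `c` succeeds. -/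
inductive Program where
  | instr (i : Instr)
  | seq (P Q : Program)
  | ite (c : Test) (P Q : Program)
  | loop (c : Test) (P : Program)

/-- `Exec P σ t σ'`: started in `σ`, the (deterministic) program `P` halts in `σ'` after exactly
`t` steps, each instruction and each evaluation of a test being one step. -/
inductive Exec : Program → State → ℕ → State → Prop where
  | instr (i : Instr) (σ : State) : Exec (.instr i) σ 1 (i.apply σ)
  | seq {P Q : Program} {σ σ₁ σ₂ : State} {t₁ t₂ : ℕ} :
      Exec P σ t₁ σ₁ → Exec Q σ₁ t₂ σ₂ → Exec (.seq P Q) σ (t₁ + t₂) σ₂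
  | iteTrue {c : Test} {P Q : Program} {σ σ' : State} {t : ℕ} :
      c.Holds σ → Exec P σ t σ' → Exec (.ite c P Q) σ (t + 1) σ'
  | iteFalse {c : Test} {P Q : Program} {σ σ' : State} {t : ℕ} :
      ¬ c.Holds σ → Exec Q σ t σ' → Exec (.ite c P Q) σ (t + 1) σ'
  | loopDone {c : Test} {P : Program} {σ : State} :
      ¬ c.Holds σ → Exec (.loop c P) σ 1 σ
  | loopStep {c : Test} {P : Program} {σ σ₁ σ₂ : State} {t₁ t₂ : ℕ} :
      c.Holds σ → Exec P σ t₁ σ₁ → Exec (.loop c P) σ₁ t₂ σ₂ →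
      Exec (.loop c P) σ (t₁ + t₂ + 1) σ₂

end RealRAM

/-! ## Robust Markov decision processes with divergence ambiguity sets -/

/-- The data of a robust Markov decision process with states `Fin S`, actions `Fin A`:
non-negative rewards `r s a s'`, a discount factor in `(0, 1)`, strictly positive nominal
transition probabilities `nominal s a s'`, and a non-negative uncertainty budget. -/
structure RobustMDP (S A : ℕ) where
  reward : Fin S → Fin A → Fin S → ℝ
  reward_nonneg : ∀ s a s', 0 ≤ reward s a s'
  discount : ℝ
  discount_pos : 0 < discount
  discount_lt_one : discount < 1
  nominal : Fin S → Fin A → Fin S → ℝ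
  nominal_mem : ∀ s a, nominal s a ∈ stdSimplex ℝ (Fin S)
  nominal_pos : ∀ s a s', 0 < nominal s a s'
  budget : ℝ
  budget_nonneg : 0 ≤ budget

/-- The `φ`-divergence of `p` from `q`. -/
def phiDivergence {S : ℕ} (φ : ℝ → ℝ) (p q : Fin S → ℝ) : ℝ :=
  ∑ i, q i * φ (p i / q i)

/-- The function `φ` of the variation distance `∑ |p i - q i|`. -/
def variationPhi (t : ℝ) : ℝ := |t - 1|

/-- The function `φ` of the `χ²`-distance `∑ (p i - q i) ^ 2 / q i`. -/
def chiSquarePhi (t : ℝ) : ℝ := (t - 1) ^ 2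

namespace RobustMDP

variable {S A : ℕ}

/-- The component at state `s` of the `s`-rectangular ambiguity set: the budget is shared by
all actions. -/
def ambiguitySet (M : RobustMDP S A) (φ : ℝ → ℝ) (s : Fin S) : Set (Fin A → Fin S → ℝ) :=
  {p | (∀ a, p a ∈ stdSimplex ℝ (Fin S)) ∧
    ∑ a, phiDivergence φ (p a) (M.nominal s a) ≤ M.budget}

/-- The robust Bellman operator: the maximum over randomized decisions of the minimum over the
ambiguity set of the expected reward plus discounted value to go. -/
def bellman (M : RobustMDP S A) (φ : ℝ → ℝ) (v : Fin S → ℝ) (s : Fin S) : ℝ :=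
  ⨆ π : stdSimplex ℝ (Fin A), ⨅ p : M.ambiguitySet φ s,
    ∑ a, (π : Fin A → ℝ) a *
      ∑ s', (p : Fin A → Fin S → ℝ) a s' * (M.reward s a s' + M.discount * v s')

/-- The bound `(1 - λ)⁻¹ * max r` on the values. -/
def valueBound (M : RobustMDP S A) : ℝ :=
  (1 - M.discount)⁻¹ * ⨆ x : Fin S × Fin A × Fin S, M.reward x.1 x.2.1 x.2.2

/-- The state `σ` holds the input `(S, A, ε, κ, λ, v, nominal, r)`, tensors being stored row by
row; registers and cells not mentioned may hold anything. -/
structure IsInput (M : RobustMDP S A) (v : Fin S → ℝ) (ε : ℝ) (σ : RealRAM.State) : Prop where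
  numStates : σ.nReg 0 = S
  numActions : σ.nReg 1 = A
  accuracy : σ.rReg 0 = ε
  budget : σ.rReg 1 = M.budget
  discount : σ.rReg 2 = M.discount
  value : ∀ s : Fin S, σ.rArr 0 s = v s
  nominal : ∀ (s : Fin S) (a : Fin A) (s' : Fin S),
    σ.rArr 1 ((s * A + a) * S + s') = M.nominal s a s'
  reward : ∀ (s : Fin S) (a : Fin A) (s' : Fin S),
    σ.rArr 2 ((s * A + a) * S + s') = M.reward s a s'

end RobustMDP

end

open scoped BigOperators

noncomputable section

namespace RealRAM

/-! ## Reasoning about programs -/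

/-! Fix a state. If one element of the ambiguity set keeps the mean of every action at most `θ`,
then no randomized decision is worth more than `θ`. If there is none, the convex set of achievable
mean vectors misses the open orthant below `θ`; the normal of a separating hyperplane is nonnegative
and nonzero, and normalized it is a randomized decision that guarantees `θ`. So feasibility at a
level `θ` tells on which side of `θ` the value lies, up to equality, which bisection tolerates
(`RobustMDP.Feasible.bellman_le`, `RobustMDP.le_bellman_of_not_feasible`). The actions interact only
through the shared budget, so feasibility means that the least divergences of the separate actions
at level `θ` add up to at most the budget (`RobustMDP.feasible_iff`).

On a row sorted by payoff each least divergence comes from one linear scan. For the variation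
distance, nominal mass is kept greedily from the lowest payoff upwards as far as the level allows,
and the rest moves to the lowest payoff. For the `χ²`-distance, the optimum is proportional to `q *
(t - z)⁺`, where `t` is the zero of an affine function built from three moments of a prefix.
Explicit candidates and matching lower bounds (`isMinDivergence_variation`,
`isMinDivergence_chiSquare`) show that the minimum is attained, without a compactness argument.

The sorting order does not depend on `θ`. Per state, merge sort therefore costs `O(A * S * (1 + log
S))` once, and each of the `O(1 + log⁺(R / ε))` halvings costs `O(A * S)`. Summed over the states
this lies below the stated product.

Programs are treated by total-correctness triples with a step bound (`Runs`), composed sequentially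
and through two loop rules; `Exec.frame` carries along whatever a subprogram cannot write. -/

/-- The natural-number registers that an instruction may overwrite. -/
def Instr.nWrites : Instr → List ℕ
  | .nConst i _ | .nMove i _ | .nAdd i _ _ | .nSub i _ _ | .nLoad i _ _ => [i]
  | _ => []

/-- The real registers that an instruction may overwrite. -/
def Instr.rWrites : Instr → List ℕ
  | .rConst i _ | .rMove i _ | .rAdd i _ _ | .rSub i _ _ | .rMul i _ _ | .rDiv i _ _
  | .rLoad i _ _ => [i]
  | _ => []

/-- The natural-number arrays that an instruction may modify. -/
def Instr.nArrWrites : Instr → List ℕ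
  | .nStore k _ _ => [k]
  | _ => []

/-- The real arrays that an instruction may modify. -/
def Instr.rArrWrites : Instr → List ℕ
  | .rStore k _ _ => [k]
  | _ => []

/-- Collect a list over all the instructions of a program. -/
def Program.collect (f : Instr → List ℕ) : Program → List ℕ
  | .instr i => f i
  | .seq P Q => P.collect f ++ Q.collect f
  | .ite _ P Q => P.collect f ++ Q.collect f
  | .loop _ P => P.collect f

/-- Two states agree on everything that the program `P` does not write. -/
structure Frame (P : Program) (σ σ' : State) : Prop where
  nReg : ∀ i, i ∉ P.collect Instr.nWrites → σ'.nReg i = σ.nReg i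
  rReg : ∀ i, i ∉ P.collect Instr.rWrites → σ'.rReg i = σ.rReg i
  nArr : ∀ i, i ∉ P.collect Instr.nArrWrites → σ'.nArr i = σ.nArr i
  rArr : ∀ i, i ∉ P.collect Instr.rArrWrites → σ'.rArr i = σ.rArr i

theorem Frame.refl (P : Program) (σ : State) : Frame P σ σ :=
  ⟨fun _ _ => rfl, fun _ _ => rfl, fun _ _ => rfl, fun _ _ => rfl⟩

theorem Frame.trans {P : Program} {σ₁ σ₂ σ₃ : State} (h : Frame P σ₁ σ₂) (h' : Frame P σ₂ σ₃) :
    Frame P σ₁ σ₃ :=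
  ⟨fun i hi => (h'.nReg i hi).trans (h.nReg i hi), fun i hi => (h'.rReg i hi).trans (h.rReg i hi),
    fun i hi => (h'.nArr i hi).trans (h.nArr i hi), fun i hi => (h'.rArr i hi).trans (h.rArr i hi)⟩

theorem Frame.of_subset {P Q : Program} {σ σ' : State} (h : Frame P σ σ')
    (hs : ∀ f, P.collect f ⊆ Q.collect f) : Frame Q σ σ' :=
  ⟨fun i hi => h.nReg i fun h' => hi (hs _ h'), fun i hi => h.rReg i fun h' => hi (hs _ h'),
    fun i hi => h.nArr i fun h' => hi (hs _ h'), fun i hi => h.rArr i fun h' => hi (hs _ h')⟩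

theorem frame_instr (i : Instr) (σ : State) : Frame (.instr i) σ (i.apply σ) := by
  cases i <;> constructor <;> intro k hk <;>
    simp_all [Program.collect, Instr.nWrites, Instr.rWrites, Instr.nArrWrites, Instr.rArrWrites,
      Instr.apply, Function.update_of_ne, updateArr]

/-- Write sets are read off the syntax, so for a concrete program the preservation of a register or
array reduces to a `decide`. -/
theorem Exec.frame {P : Program} {σ σ' : State} {t : ℕ} (h : Exec P σ t σ') : Frame P σ σ' := by
  induction h with
  | instr i σ => exact frame_instr i σ
  | seq _ _ ih₁ ih₂ =>
    exact (ih₁.of_subset fun f => List.subset_append_left _ _).trans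
      (ih₂.of_subset fun f => List.subset_append_right _ _)
  | iteTrue _ _ ih => exact ih.of_subset fun f => List.subset_append_left _ _
  | iteFalse _ _ ih => exact ih.of_subset fun f => List.subset_append_right _ _
  | loopDone _ => exact Frame.refl _ _
  | loopStep _ _ _ ih₁ ih₂ =>
    exact Frame.trans (P := .loop _ _) (ih₁.of_subset fun f => List.Subset.refl _) ih₂

/-- Started in `σ`, the program `P` halts within `T` steps in a state that satisfies `Q`. -/
def Runs (P : Program) (σ : State) (T : ℕ) (Q : State → Prop) : Prop :=
  ∃ (t : ℕ) (σ' : State), Exec P σ t σ' ∧ t ≤ T ∧ Q σ'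

theorem Runs.mono {P : Program} {σ : State} {T T' : ℕ} {Q Q' : State → Prop} (h : Runs P σ T Q)
    (hT : T ≤ T') (hQ : ∀ σ', Frame P σ σ' → Q σ' → Q' σ') : Runs P σ T' Q' := by
  obtain ⟨t, σ', he, ht, hq⟩ := h
  exact ⟨t, σ', he, ht.trans hT, hQ _ he.frame hq⟩

theorem Runs.seq {P P' : Program} {σ : State} {T₁ T₂ T : ℕ} {Q₁ Q₂ : State → Prop}
    (h₁ : Runs P σ T₁ Q₁) (h₂ : ∀ σ', Frame P σ σ' → Q₁ σ' → Runs P' σ' T₂ Q₂)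
    (hT : T₁ + T₂ ≤ T) : Runs (.seq P P') σ T Q₂ := by
  obtain ⟨t, σ', he, ht, hq⟩ := h₁
  obtain ⟨t', σ'', he', ht', hq'⟩ := h₂ σ' he.frame hq
  exact ⟨t + t', σ'', .seq he he', by omega, hq'⟩

theorem Runs.ite {c : Test} {P P' : Program} {σ : State} {T : ℕ} {Q : State → Prop}
    (h₁ : c.Holds σ → Runs P σ T Q) (h₂ : ¬ c.Holds σ → Runs P' σ T Q) :
    Runs (.ite c P P') σ (T + 1) Q := by
  by_cases hc : c.Holds σ
  · obtain ⟨t, σ', he, ht, hq⟩ := h₁ hc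
    exact ⟨t + 1, σ', .iteTrue hc he, by omega, hq⟩
  · obtain ⟨t, σ', he, ht, hq⟩ := h₂ hc
    exact ⟨t + 1, σ', .iteFalse hc he, by omega, hq⟩

/-- A nonempty sequence of instructions. -/
def block : Instr → List Instr → Program
  | i, [] => .instr i
  | i, j :: l => .seq (.instr i) (block j l)

theorem Runs.block {i : Instr} {l : List Instr} {σ : State} {Q : State → Prop}
    (h : Q (l.foldl (fun σ i => i.apply σ) (i.apply σ))) :
    Runs (block i l) σ (l.length + 1) Q := by
  induction l generalizing i σ with
  | nil => exact ⟨1, _, .instr i σ, le_rfl, h⟩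
  | cons j l ih =>
    obtain ⟨t, σ', he, ht, hq⟩ := ih (i := j) (σ := i.apply σ) h
    exact ⟨1 + t, σ', .seq (.instr i σ) he, by simp; omega, hq⟩

/-- A loop whose number of iterations is known in advance. -/
theorem Runs.loop {c : Test} {P : Program} {σ₀ : State} {n T : ℕ} (I : ℕ → State → Prop)
    (h₀ : I 0 σ₀)
    (hstep : ∀ j < n, ∀ σ, Frame P σ₀ σ → I j σ → c.Holds σ ∧ Runs P σ T (I (j + 1)))
    (hend : ∀ σ, Frame P σ₀ σ → I n σ → ¬ c.Holds σ) :
    Runs (.loop c P) σ₀ (n * (T + 1) + 1) (I n) := by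
  have key : ∀ m j σ, j + m = n → Frame P σ₀ σ → I j σ →
      Runs (.loop c P) σ (m * (T + 1) + 1) (I n) := by
    intro m
    induction m with
    | zero =>
      intro j σ hj hF hI
      obtain rfl : j = n := by omega
      exact ⟨1, σ, .loopDone (hend σ hF hI), by omega, hI⟩
    | succ m ih =>
      intro j σ hj hF hI
      obtain ⟨hc, t, σ', he, ht, hq⟩ := hstep j (by omega) σ hF hI
      obtain ⟨t', σ'', he', ht', hq'⟩ := ih (j + 1) σ' (by omega) (hF.trans he.frame) hq
      refine ⟨t + t' + 1, σ'', .loopStep hc he he', ?_, hq'⟩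
      rw [Nat.succ_mul]; omega
  exact key n 0 σ₀ (by omega) (Frame.refl _ _) h₀

/-- A loop that stops within `n` iterations, by a rank `I` that decreases in every iteration. -/
theorem Runs.loop_of_rank {c : Test} {P : Program} {σ₀ : State} {n T : ℕ} (I : ℕ → State → Prop)
    (h₀ : I n σ₀)
    (hstep : ∀ j σ, Frame P σ₀ σ → I j σ → c.Holds σ →
      ∃ j', j = j' + 1 ∧ Runs P σ T (I j')) :
    Runs (.loop c P) σ₀ (n * (T + 1) + 1) (fun σ => ¬ c.Holds σ ∧ ∃ j, I j σ) := by
  have key : ∀ m σ, Frame P σ₀ σ → I m σ →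
      Runs (.loop c P) σ (m * (T + 1) + 1) (fun σ => ¬ c.Holds σ ∧ ∃ j, I j σ) := by
    intro m
    induction m with
    | zero =>
      intro σ hF hI
      have hc : ¬ c.Holds σ := fun hc => by
        obtain ⟨j', hj, -⟩ := hstep 0 σ hF hI hc
        omega
      exact ⟨1, σ, .loopDone hc, by omega, hc, 0, hI⟩
    | succ m ih =>
      intro σ hF hI
      by_cases hc : c.Holds σ
      · obtain ⟨j', hj, t, σ', he, ht, hq⟩ := hstep (m + 1) σ hF hI hc
        obtain rfl : m = j' := by omega
        obtain ⟨t', σ'', he', ht', hq'⟩ := ih σ' (hF.trans he.frame) hq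
        refine ⟨t + t' + 1, σ'', .loopStep hc he he', ?_, hq'⟩
        rw [Nat.succ_mul]; omega
      · exact ⟨1, σ, .loopDone hc, by omega, hc, m + 1, hI⟩
  exact key n σ₀ (Frame.refl _ _) h₀

theorem updateArr_apply {α : Type} (m : ℕ → ℕ → α) (k i : ℕ) (x : α) (k' i' : ℕ) :
    updateArr m k i x k' i' = if k' = k ∧ i' = i then x else m k' i' := by
  unfold updateArr
  by_cases h : k' = k
  · subst h
    by_cases h' : i' = i <;> simp [h']
  · simp [h]

end RealRAM

/-! ## The bisection test -/

/-- `D` is the least divergence from `q` of a distribution under which `z` has mean at most `θ`. -/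
def IsMinDivergence {S : ℕ} (φ : ℝ → ℝ) (z q : Fin S → ℝ) (θ D : ℝ) : Prop :=
  IsLeast ((fun p => phiDivergence φ p q) '' {p ∈ stdSimplex ℝ (Fin S) | ∑ i, p i * z i ≤ θ}) D

/-- Relabelling outcomes is a bijection of the simplex that preserves means and divergences; it
transfers results from the sorted row to the original one. -/
theorem IsMinDivergence.of_perm {S : ℕ} {φ : ℝ → ℝ} {z q : Fin S → ℝ} {θ D : ℝ}
    (π : Equiv.Perm (Fin S)) (h : IsMinDivergence φ (z ∘ π) (q ∘ π) θ D) :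
    IsMinDivergence φ z q θ D := by
  obtain ⟨⟨p, ⟨⟨hp0, hp1⟩, hpz⟩, hpD⟩, hlb⟩ := h
  refine ⟨⟨p ∘ π.symm, ⟨⟨fun i => hp0 _, ?_⟩, ?_⟩, ?_⟩, ?_⟩
  · simpa [Function.comp_apply, Equiv.sum_comp π.symm p] using hp1
  · rw [← Equiv.sum_comp π]
    simpa using hpz
  · rw [← hpD]
    simp only [phiDivergence]
    rw [← Equiv.sum_comp π]
    simp
  · rintro _ ⟨p', ⟨⟨hp0', hp1'⟩, hpz'⟩, rfl⟩
    refine hlb ⟨p' ∘ π, ⟨⟨fun i => hp0' _, ?_⟩, ?_⟩, ?_⟩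
    · simpa [Function.comp_apply, Equiv.sum_comp π p'] using hp1'
    · simpa [Function.comp_apply, Equiv.sum_comp π (fun i => p' i * z i)] using hpz'
    · simp only [phiDivergence, Function.comp_apply]
      exact Equiv.sum_comp π (fun i => q i * φ (p' i / q i))

/-! ### Minimax duality at one state -/

namespace RobustMDP

variable {S A : ℕ}

/-- Reward plus discounted value to go. -/
def payoff (M : RobustMDP S A) (v : Fin S → ℝ) (s : Fin S) (a : Fin A) (s' : Fin S) : ℝ :=
  M.reward s a s' + M.discount * v s'

/-- Some element of the ambiguity set keeps the value of every action at most `θ`. -/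
def Feasible (M : RobustMDP S A) (φ : ℝ → ℝ) (v : Fin S → ℝ) (s : Fin S) (θ : ℝ) : Prop :=
  ∃ p ∈ M.ambiguitySet φ s, ∀ a, ∑ s', p a s' * M.payoff v s a s' ≤ θ

/-- Apart from the budget, the constraints involve one action at a time. Minimizers chosen action by
action therefore form a jointly optimal family. -/
theorem feasible_iff {M : RobustMDP S A} {φ : ℝ → ℝ} {v : Fin S → ℝ} {s : Fin S} {θ : ℝ}
    {D : Fin A → ℝ} (hD : ∀ a, IsMinDivergence φ (M.payoff v s a) (M.nominal s a) θ (D a)) :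
    M.Feasible φ v s θ ↔ ∑ a, D a ≤ M.budget := by
  constructor
  · rintro ⟨p, ⟨hp, hpb⟩, hpz⟩
    refine le_trans (Finset.sum_le_sum fun a _ => ?_) hpb
    exact (hD a).2 ⟨p a, ⟨hp a, hpz a⟩, rfl⟩
  · intro h
    choose p hp hpD using fun a => (hD a).1
    refine ⟨p, ⟨fun a => (hp a).1, ?_⟩, fun a => (hp a).2⟩
    simpa only [hpD] using h

theorem sum_payoff_mem {M : RobustMDP S A} {v : Fin S → ℝ} {s : Fin S} {a : Fin A} {l u : ℝ}
    (hl : ∀ s', l ≤ M.payoff v s a s') (hu : ∀ s', M.payoff v s a s' ≤ u) {p : Fin S → ℝ}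
    (hp : p ∈ stdSimplex ℝ (Fin S)) :
    l ≤ ∑ s', p s' * M.payoff v s a s' ∧ ∑ s', p s' * M.payoff v s a s' ≤ u := by
  constructor
  · calc l = ∑ s', p s' * l := by rw [← Finset.sum_mul, hp.2, one_mul]
      _ ≤ _ := Finset.sum_le_sum fun i _ => mul_le_mul_of_nonneg_left (hl i) (hp.1 i)
  · calc _ ≤ ∑ s', p s' * u :=
          Finset.sum_le_sum fun i _ => mul_le_mul_of_nonneg_left (hu i) (hp.1 i)
      _ = u := by rw [← Finset.sum_mul, hp.2, one_mul]

/-- The real-valued `⨆` and `⨅` in `bellman` are meaningful only on bounded families; this supplies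
the bounds. -/
theorem exists_payoff_bound (M : RobustMDP S A) (v : Fin S → ℝ) :
    ∃ B : ℝ, ∀ s a s', |M.payoff v s a s'| ≤ B := by
  obtain ⟨B, hB⟩ := (Set.finite_range
    (fun x : Fin S × Fin A × Fin S => |M.payoff v x.1 x.2.1 x.2.2|)).bddAbove
  exact ⟨B, fun s a s' => hB ⟨(s, a, s'), rfl⟩⟩

theorem nominal_mem_ambiguitySet {M : RobustMDP S A} {φ : ℝ → ℝ} (h1 : φ 1 = 0) (s : Fin S) :
    M.nominal s ∈ M.ambiguitySet φ s := by
  refine ⟨M.nominal_mem s, ?_⟩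
  have : ∀ a, phiDivergence φ (M.nominal s a) (M.nominal s a) = 0 := fun a =>
    Finset.sum_eq_zero fun i _ => by rw [div_self (M.nominal_pos s a i).ne', h1, mul_zero]
  simpa [this] using M.budget_nonneg

theorem sum_weighted_le {π f : Fin A → ℝ} (hπ : π ∈ stdSimplex ℝ (Fin A)) {θ : ℝ}
    (h : ∀ a, f a ≤ θ) : ∑ a, π a * f a ≤ θ :=
  calc _ ≤ ∑ a, π a * θ := Finset.sum_le_sum fun a _ => mul_le_mul_of_nonneg_left (h a) (hπ.1 a)
    _ = θ := by rw [← Finset.sum_mul, hπ.2, one_mul]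

theorem le_sum_weighted {π f : Fin A → ℝ} (hπ : π ∈ stdSimplex ℝ (Fin A)) {θ : ℝ}
    (h : ∀ a, θ ≤ f a) : θ ≤ ∑ a, π a * f a :=
  calc θ = ∑ a, π a * θ := by rw [← Finset.sum_mul, hπ.2, one_mul]
    _ ≤ _ := Finset.sum_le_sum fun a _ => mul_le_mul_of_nonneg_left (h a) (hπ.1 a)

theorem bddBelow_values (M : RobustMDP S A) (φ : ℝ → ℝ) (v : Fin S → ℝ) (s : Fin S)
    (π : stdSimplex ℝ (Fin A)) :
    BddBelow (Set.range fun p : M.ambiguitySet φ s =>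
      ∑ a, (π : Fin A → ℝ) a * ∑ s', (p : Fin A → Fin S → ℝ) a s' * M.payoff v s a s') := by
  obtain ⟨B, hB⟩ := M.exists_payoff_bound v
  refine ⟨-B, ?_⟩
  rintro _ ⟨p, rfl⟩
  exact le_sum_weighted π.2 fun a =>
    (sum_payoff_mem (fun s' => (abs_le.1 (hB s a s')).1) (fun s' => (abs_le.1 (hB s a s')).2)
      (p.2.1 a)).1

/-- The easy half of minimax: the same `p` answers every decision `π`. -/
theorem Feasible.bellman_le {M : RobustMDP S A} {φ : ℝ → ℝ} {v : Fin S → ℝ} {s : Fin S} {θ : ℝ}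
    (hA : 0 < A) (h : M.Feasible φ v s θ) : M.bellman φ v s ≤ θ := by
  obtain ⟨p, hp, hpθ⟩ := h
  have : Nonempty (stdSimplex ℝ (Fin A)) := ⟨_, single_mem_stdSimplex ℝ (⟨0, hA⟩ : Fin A)⟩
  refine ciSup_le fun π => ?_
  refine (ciInf_le (bddBelow_values M φ v s π) ⟨p, hp⟩).trans ?_
  exact sum_weighted_le π.2 hpθ

theorem le_bellman_of_weights {M : RobustMDP S A} {φ : ℝ → ℝ} {v : Fin S → ℝ} {s : Fin S}
    {θ : ℝ} (h1 : φ 1 = 0) {π : Fin A → ℝ} (hπ : π ∈ stdSimplex ℝ (Fin A))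
    (h : ∀ p ∈ M.ambiguitySet φ s, θ ≤ ∑ a, π a * ∑ s', p a s' * M.payoff v s a s') :
    θ ≤ M.bellman φ v s := by
  have hne : Nonempty (M.ambiguitySet φ s) := ⟨⟨_, nominal_mem_ambiguitySet h1 s⟩⟩
  obtain ⟨B, hB⟩ := M.exists_payoff_bound v
  refine (le_ciInf fun p : M.ambiguitySet φ s => h p.1 p.2).trans
    (le_ciSup (f := fun π : stdSimplex ℝ (Fin A) => ⨅ p : M.ambiguitySet φ s,
      ∑ a, (π : Fin A → ℝ) a * ∑ s', (p : Fin A → Fin S → ℝ) a s' * M.payoff v s a s')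
      ?_ ⟨π, hπ⟩)
  refine ⟨B, ?_⟩
  rintro _ ⟨π', rfl⟩
  refine (ciInf_le (bddBelow_values M φ v s π') hne.some).trans ?_
  exact sum_weighted_le π'.2 fun a =>
    (sum_payoff_mem (fun s' => (abs_le.1 (hB s a s')).1) (fun s' => (abs_le.1 (hB s a s')).2)
      (hne.some.2.1 a)).2

/-- With the nominal row fixed, the divergence is a positive combination of `φ` composed with affine
maps of `p`. -/
theorem convex_ambiguitySet (M : RobustMDP S A) {φ : ℝ → ℝ} (hφ : ConvexOn ℝ Set.univ φ)
    (s : Fin S) : Convex ℝ (M.ambiguitySet φ s) := by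
  rintro p ⟨hp, hpb⟩ p' ⟨hp', hpb'⟩ x y hx hy hxy
  refine ⟨fun a => convex_stdSimplex ℝ (Fin S) (hp a) (hp' a) hx hy hxy, ?_⟩
  have key : ∀ a, phiDivergence φ ((x • p + y • p') a) (M.nominal s a) ≤
      x * phiDivergence φ (p a) (M.nominal s a) + y * phiDivergence φ (p' a) (M.nominal s a) := by
    intro a
    simp only [phiDivergence, Finset.mul_sum]
    rw [← Finset.sum_add_distrib]
    refine Finset.sum_le_sum fun i _ => ?_
    have hq := M.nominal_pos s a i
    have := hφ.2 (Set.mem_univ (p a i / M.nominal s a i)) (Set.mem_univ (p' a i / M.nominal s a i))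
      hx hy hxy
    simp only [smul_eq_mul] at this
    have h2 : (x • p + y • p') a i / M.nominal s a i =
        x * (p a i / M.nominal s a i) + y * (p' a i / M.nominal s a i) := by
      simp only [Pi.add_apply, Pi.smul_apply, smul_eq_mul]
      ring
    rw [h2]
    calc _ ≤ M.nominal s a i * _ := mul_le_mul_of_nonneg_left this hq.le
      _ = _ := by ring
  refine (Finset.sum_le_sum fun a _ => key a).trans ?_
  rw [Finset.sum_add_distrib, ← Finset.mul_sum, ← Finset.mul_sum]
  calc _ ≤ x * M.budget + y * M.budget := by gcongr
    _ = M.budget := by rw [← add_mul, hxy, one_mul]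

/-- The hard half of minimax, by Hahn–Banach separation of the mean vectors from the orthant
strictly below `θ`. Openness of the orthant suffices for the separation, so neither set has to be
compact. -/
theorem le_bellman_of_not_feasible {M : RobustMDP S A} {φ : ℝ → ℝ} {v : Fin S → ℝ} {s : Fin S}
    {θ : ℝ} (hφ : ConvexOn ℝ Set.univ φ) (h1 : φ 1 = 0) (h : ¬ M.Feasible φ v s θ) :
    θ ≤ M.bellman φ v s := by
  let F : (Fin A → Fin S → ℝ) →ₗ[ℝ] (Fin A → ℝ) :=
    { toFun := fun p a => ∑ s', p a s' * M.payoff v s a s'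
      map_add' := fun p p' => by
        ext a
        simp [add_mul, Finset.sum_add_distrib]
      map_smul' := fun c p => by
        ext a
        simp [mul_assoc, Finset.mul_sum] }
  let U : Set (Fin A → ℝ) := Set.univ.pi fun _ => Set.Iio θ
  have hUo : IsOpen U := isOpen_set_pi Set.finite_univ fun _ _ => isOpen_Iio
  have hUc : Convex ℝ U := convex_pi fun _ _ => convex_Iio θ
  have hK : Convex ℝ (F '' M.ambiguitySet φ s) := (convex_ambiguitySet M hφ s).linear_image F
  have hdisj : Disjoint U (F '' M.ambiguitySet φ s) := by
    rw [Set.disjoint_left]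
    rintro _ hU ⟨p, hp, rfl⟩
    exact h ⟨p, hp, fun a => (hU a (Set.mem_univ a)).le⟩
  obtain ⟨f, u, hfU, hfK⟩ := geometric_hahn_banach_open hUc hUo hK hdisj
  set g : Fin A → ℝ := fun a => f (Pi.single a 1) with hg
  have hf : ∀ x, f x = ∑ a, g a * x a := by
    intro x
    conv_lhs => rw [← Finset.univ_sum_single x]
    rw [map_sum]
    refine Finset.sum_congr rfl fun a _ => ?_
    have : (Pi.single a (x a) : Fin A → ℝ) = x a • Pi.single a 1 := by
      rw [← Pi.single_smul]; simp
    rw [this, map_smul, smul_eq_mul, mul_comm]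
  have hU1 : ∀ y : Fin A → ℝ, (∀ a, 0 < y a) → ∑ a, g a * (θ - y a) < u := by
    intro y hy
    rw [← hf fun a => θ - y a]
    exact hfU _ fun a _ => by simpa using hy a
  have hg0 : ∀ a, 0 ≤ g a := by
    intro a
    by_contra hneg
    push Not at hneg
    let B := ∑ b, g b * (θ - 1)
    -- If `g a` were negative, lowering coordinate `a` far enough would stay in the orthant but push
    -- the functional above `u`.
    have hB := hU1 (fun b => 1 + if b = a then (|u - B| + 1) / (- g a) else 0) (fun b => by
      have : 0 < (|u - B| + 1) / (- g a) := by
        have : 0 < - g a := by linarith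
        positivity
      split_ifs <;> linarith)
    have h2 : ∑ b, g b * (θ - (1 + if b = a then (|u - B| + 1) / (- g a) else 0)) =
        B + (|u - B| + 1) := by
      have : ∀ b, g b * (θ - (1 + if b = a then (|u - B| + 1) / (- g a) else 0)) =
          g b * (θ - 1) + if b = a then (|u - B| + 1) else 0 := by
        intro b
        split_ifs with hb
        · subst hb
          have hne := hneg.ne
          field_simp
          ring
        · ring
      simp only [this, Finset.sum_add_distrib]
      simp [B]
    rw [h2] at hB
    have := le_abs_self (u - B)
    linarith
  have hpos : 0 < ∑ a, g a := by
    refine lt_of_le_of_ne (Finset.sum_nonneg fun a _ => hg0 a) fun h0 => ?_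
    have hz : ∀ a, g a = 0 := fun a =>
      (Finset.sum_eq_zero_iff_of_nonneg fun a _ => hg0 a).1 h0.symm a (Finset.mem_univ a)
    -- Were all weights zero, the functional would vanish on both sets, giving `0 < u` and `u ≤ 0`.
    have e1 := hU1 (fun _ => 1) fun _ => one_pos
    have e2 := hfK _ ⟨_, nominal_mem_ambiguitySet h1 s, rfl⟩
    rw [hf] at e2
    simp only [hz, zero_mul, Finset.sum_const_zero] at e1 e2
    linarith
  have hθ : θ * ∑ a, g a ≤ u := by
    refine le_of_forall_pos_lt_add fun η hη => ?_
    -- This shift lowers the functional by exactly `η`, so letting `η` tend to `0` reaches the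
    -- corner of the orthant.
    have := hU1 (fun _ => η / ∑ a, g a) fun _ => by positivity
    rw [← Finset.sum_mul, mul_sub, mul_div_cancel₀ _ hpos.ne'] at this
    linarith
  refine le_bellman_of_weights h1 (π := fun a => g a / ∑ b, g b)
    ⟨fun a => div_nonneg (hg0 a) hpos.le, by rw [← Finset.sum_div, div_self hpos.ne']⟩ ?_
  intro p hp
  have e := hfK _ ⟨p, hp, rfl⟩
  rw [hf] at e
  have : ∑ a, g a / (∑ b, g b) * ∑ s', p a s' * M.payoff v s a s' =
      (∑ a, g a * F p a) / ∑ b, g b := by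
    rw [Finset.sum_div]
    exact Finset.sum_congr rfl fun a _ => by rw [div_mul_eq_mul_div]; rfl
  rw [this, le_div_iff₀ hpos]
  linarith

/-- Always playing `a` guarantees its least payoff; this validates the initial lower bound of the
bisection. -/
theorem le_bellman_of_le_payoff {M : RobustMDP S A} {φ : ℝ → ℝ} {v : Fin S → ℝ} {s : Fin S}
    {θ : ℝ} (h1 : φ 1 = 0) (a : Fin A) (h : ∀ s', θ ≤ M.payoff v s a s') :
    θ ≤ M.bellman φ v s := by
  refine le_bellman_of_weights h1 (single_mem_stdSimplex ℝ a) fun p hp => ?_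
  have : ∑ b, (Pi.single a 1 : Fin A → ℝ) b * ∑ s', p b s' * M.payoff v s b s' =
      ∑ s', p a s' * M.payoff v s a s' := by
    simp [Pi.single_apply]
  rw [this]
  calc θ = ∑ s', p a s' * θ := by rw [← Finset.sum_mul, (hp.1 a).2, one_mul]
    _ ≤ _ := Finset.sum_le_sum fun i _ => mul_le_mul_of_nonneg_left (h i) ((hp.1 a).1 i)

theorem feasible_of_payoff_le {M : RobustMDP S A} {φ : ℝ → ℝ} {v : Fin S → ℝ} {s : Fin S}
    {θ : ℝ} (h1 : φ 1 = 0) (h : ∀ a s', M.payoff v s a s' ≤ θ) : M.Feasible φ v s θ := by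
  refine ⟨_, nominal_mem_ambiguitySet h1 s, fun a => ?_⟩
  have hm := M.nominal_mem s a
  calc _ ≤ ∑ s', M.nominal s a s' * θ :=
        Finset.sum_le_sum fun i _ => mul_le_mul_of_nonneg_left (h a i) (hm.1 i)
    _ = θ := by rw [← Finset.sum_mul, hm.2, one_mul]

end RobustMDP

/-! ## The least divergence on a sorted row -/

/-- A row of values and probabilities, sorted by value, and a level not below the least value. -/
structure SortedRow (S : ℕ) (z q : ℕ → ℝ) (θ : ℝ) : Prop where
  size_pos : 0 < S
  mono : ∀ i j, i ≤ j → j < S → z i ≤ z j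
  weight_pos : ∀ i < S, 0 < q i
  weight_sum : ∑ i ∈ Finset.range S, q i = 1
  first_le : z 0 ≤ θ

theorem phiDivergence_chiSquare {S : ℕ} {p q : Fin S → ℝ} (hq : ∀ i, 0 < q i)
    (hp1 : ∑ i, p i = 1) (hq1 : ∑ i, q i = 1) :
    phiDivergence chiSquarePhi p q = ∑ i, p i ^ 2 / q i - 1 := by
  have : ∀ i, q i * chiSquarePhi (p i / q i) = p i ^ 2 / q i - 2 * p i + q i := by
    intro i
    have := (hq i).ne'
    simp only [chiSquarePhi]
    field_simp
    ring
  simp only [phiDivergence, this, Finset.sum_add_distrib, Finset.sum_sub_distrib,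
    ← Finset.mul_sum, hp1, hq1]
  ring

theorem isMinDivergence_zero {S : ℕ} {φ : ℝ → ℝ} {z q : Fin S → ℝ} {θ : ℝ} (h1 : φ 1 = 0)
    (h0 : ∀ t, 0 ≤ φ t) (hq : ∀ i, 0 < q i) (hq1 : ∑ i, q i = 1) (hm : ∑ i, q i * z i ≤ θ) :
    IsMinDivergence φ z q θ 0 := by
  refine ⟨⟨q, ⟨⟨fun i => (hq i).le, hq1⟩, hm⟩, Finset.sum_eq_zero fun i _ => ?_⟩, ?_⟩
  · rw [div_self (hq i).ne', h1, mul_zero]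
  · rintro _ ⟨p, -, rfl⟩
    exact Finset.sum_nonneg fun i _ => mul_nonneg (hq i).le (h0 _)

/-- The `χ²`-optimal distribution is proportional to `q * (t - z)⁺` for a threshold `t`. -/
theorem isMinDivergence_chiSquare {S : ℕ} {z q : Fin S → ℝ} {θ t W : ℝ} (hq : ∀ i, 0 < q i)
    (hq1 : ∑ i, q i = 1) (hW : W = ∑ i, q i * max 0 (t - z i)) (hWpos : 0 < W)
    (hroot : ∑ i, q i * max 0 (t - z i) * (z i - θ) = 0) :
    IsMinDivergence chiSquarePhi z q θ ((t - θ) / W - 1) := by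
  set m : Fin S → ℝ := fun i => max 0 (t - z i) with hm
  have hmm : ∀ i, m i * m i = m i * (t - z i) := by
    intro i
    simp only [hm]
    rcases le_total 0 (t - z i) with h | h
    · rw [max_eq_right h]
    · rw [max_eq_left h]; ring
  have hm0 : ∀ i, 0 ≤ m i := fun i => le_max_left _ _
  -- Since `m * m = m * (t - z)`, the root condition turns the second moment of `m` into `(t - θ) *
  -- W`; its nonnegativity then gives `θ ≤ t`.
  have hG : ∑ i, q i * m i ^ 2 = (t - θ) * W := by
    have : ∀ i, q i * m i ^ 2 = (t - θ) * (q i * m i) - q i * m i * (z i - θ) := by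
      intro i
      rw [sq, hmm]; ring
    simp only [this, Finset.sum_sub_distrib, ← Finset.mul_sum, hW]
    rw [hroot, sub_zero]
  have ht : 0 ≤ t - θ := by
    have h0 : 0 ≤ (t - θ) * W := by
      rw [← hG]
      exact Finset.sum_nonneg fun i _ => mul_nonneg (hq i).le (sq_nonneg _)
    exact nonneg_of_mul_nonneg_left h0 hWpos
  have hp1 : ∑ i, q i * m i / W = 1 := by
    rw [← Finset.sum_div, ← hW, div_self hWpos.ne']
  constructor
  · refine ⟨fun i => q i * m i / W, ⟨⟨fun i => ?_, hp1⟩, ?_⟩, ?_⟩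
    · exact div_nonneg (mul_nonneg (hq i).le (hm0 i)) hWpos.le
    · have : ∀ i, q i * m i / W * z i = (q i * m i * (z i - θ)) / W + θ * (q i * m i / W) := by
        intro i; ring
      simp only [this, Finset.sum_add_distrib, ← Finset.sum_div, ← Finset.mul_sum]
      rw [hroot, ← hW, div_self hWpos.ne']
      simp
    · simp only
      rw [phiDivergence_chiSquare hq hp1 hq1]
      have : ∀ i, (q i * m i / W) ^ 2 / q i = q i * m i ^ 2 / W ^ 2 := by
        intro i
        have := (hq i).ne'
        field_simp
      simp only [this, ← Finset.sum_div, hG]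
      field_simp
  · rintro _ ⟨p, ⟨⟨hp0, hp1⟩, hpz⟩, rfl⟩
    simp only
    rw [phiDivergence_chiSquare hq hp1 hq1]
    refine sub_le_sub_right ?_ 1
    -- The optimality certificate: the tangent inequality of `p ^ 2 / q` at the candidate `q * m /
    -- W`, weakened by `t - z ≤ m`. Summed over `i`, the right-hand side of the mean constraint
    -- appears.
    have key : ∀ i, 2 * (p i * ((t - z i) / W)) - q i * m i ^ 2 / W ^ 2 ≤ p i ^ 2 / q i := by
      intro i
      have hqi := hq i
      have h1 : p i * ((t - z i) / W) ≤ p i * (m i / W) :=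
        mul_le_mul_of_nonneg_left (div_le_div_of_nonneg_right (le_max_right _ _) hWpos.le) (hp0 i)
      have h2 : 0 ≤ (p i - q i * (m i / W)) ^ 2 / q i := by positivity
      have h3 : (p i - q i * (m i / W)) ^ 2 / q i =
          p i ^ 2 / q i - 2 * (p i * (m i / W)) + q i * m i ^ 2 / W ^ 2 := by
        field_simp
        ring
      linarith
    have hs := Finset.sum_le_sum fun i (_ : i ∈ Finset.univ) => key i
    rw [Finset.sum_sub_distrib, ← Finset.mul_sum, ← Finset.sum_div, hG] at hs
    have h4 : ∑ i, p i * ((t - z i) / W) = (t - ∑ i, p i * z i) / W := by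
      have : ∀ i, p i * ((t - z i) / W) = t * p i / W - p i * z i / W := by intro i; ring
      simp only [this, Finset.sum_sub_distrib, ← Finset.sum_div, ← Finset.mul_sum, hp1]
      ring
    have h5 : (t - θ) / W ≤ (t - ∑ i, p i * z i) / W :=
      div_le_div_of_nonneg_right (by linarith) hWpos.le
    have h6 : (t - θ) * W / W ^ 2 = (t - θ) / W := by field_simp
    rw [h4, h6] at hs
    linarith

/-- The variation-optimal distribution keeps the mass `g` and moves the rest to a best outcome. -/
theorem isMinDivergence_variation {S : ℕ} {z q g : Fin S → ℝ} {θ t : ℝ} (i₀ : Fin S)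
    (hq : ∀ i, 0 < q i) (hq1 : ∑ i, q i = 1) (hmin : ∀ i, z i₀ ≤ z i)
    (hg0 : ∀ i, 0 ≤ g i) (hgq : ∀ i, g i ≤ q i)
    (hgz : ∑ i, g i * (z i - z i₀) = θ - z i₀) (ht : z i₀ < t)
    (hlt : ∀ i, z i < t → g i = q i) (hgt : ∀ i, t < z i → g i = 0) :
    IsMinDivergence variationPhi z q θ (2 * ∑ i, (q i - g i)) := by
  have hvar : ∀ p : Fin S → ℝ, phiDivergence variationPhi p q = ∑ i, |p i - q i| := by
    intro p
    refine Finset.sum_congr rfl fun i _ => ?_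
    have hqi := hq i
    have : p i / q i - 1 = (p i - q i) / q i := by field_simp
    rw [variationPhi, this, abs_div, abs_of_pos hqi, mul_div_cancel₀ _ hqi.ne']
  set δ := ∑ i, (q i - g i) with hδ
  have hδ0 : 0 ≤ δ := Finset.sum_nonneg fun i _ => sub_nonneg.2 (hgq i)
  have hgs : ∑ i, g i = 1 - δ := by
    rw [hδ, Finset.sum_sub_distrib, hq1]; ring
  let p : Fin S → ℝ := fun i => g i + if i = i₀ then δ else 0
  have hp : p ∈ stdSimplex ℝ (Fin S) := by
    refine ⟨fun i => ?_, ?_⟩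
    · simp only [p]
      split_ifs
      · exact add_nonneg (hg0 i) hδ0
      · simpa using hg0 i
    · simp only [p, Finset.sum_add_distrib, Finset.sum_ite_eq', Finset.mem_univ, if_true, hgs]
      ring
  have hpz : ∑ i, p i * z i ≤ θ := by
    have : ∀ i, p i * z i = g i * (z i - z i₀) + z i₀ * g i + if i = i₀ then δ * z i₀ else 0 := by
      intro i
      simp only [p]
      split_ifs with h
      · subst h; ring
      · ring
    simp only [this, Finset.sum_add_distrib, hgz, ← Finset.mul_sum, hgs, Finset.sum_ite_eq',
      Finset.mem_univ, if_true]
    linarith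
  -- This bound also gives the inequality `2 * δ ≤` divergence of `p`, so for the candidate only an
  -- upper estimate remains.
  have hlb : 2 * δ ∈ lowerBounds ((fun p => phiDivergence variationPhi p q) ''
      {p ∈ stdSimplex ℝ (Fin S) | ∑ i, p i * z i ≤ θ}) := by
    rintro _ ⟨p', ⟨⟨hp0, hp1⟩, hpz⟩, rfl⟩
    simp only
    rw [hvar]
    set c := t - z i₀ with hc
    have hcpos : 0 < c := sub_pos.2 ht
    -- The dual certificate is the payoff excess truncated at `c`. It lies below the true excess, so
    -- it respects the mean constraint, and under `q` it exceeds the allowance by exactly `δ * c`.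
    set w : Fin S → ℝ := fun i => min (z i - z i₀) c with hw
    have hw0 : ∀ i, 0 ≤ w i := fun i => le_min (sub_nonneg.2 (hmin i)) hcpos.le
    have hwc : ∀ i, w i ≤ c := fun i => min_le_right _ _
    have h1 : ∑ i, p' i * w i ≤ θ - z i₀ := by
      calc _ ≤ ∑ i, p' i * (z i - z i₀) :=
            Finset.sum_le_sum fun i _ => mul_le_mul_of_nonneg_left (min_le_left _ _) (hp0 i)
        _ = ∑ i, p' i * z i - z i₀ := by
            simp only [mul_sub, Finset.sum_sub_distrib, ← Finset.sum_mul, hp1, one_mul]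
        _ ≤ _ := by linarith
    have h2 : ∑ i, q i * w i = θ - z i₀ + δ * c := by
      have : ∀ i, q i * w i = g i * (z i - z i₀) + (q i - g i) * c := by
        intro i
        rcases lt_trichotomy (z i) t with h | h | h
        · rw [hlt i h]
          simp only [hw, hc]
          rw [min_eq_left (by linarith)]; ring
        · simp only [hw, hc, h, min_self]; ring
        · rw [hgt i h]
          simp only [hw, hc]
          rw [min_eq_right (by linarith)]; ring
      simp only [this, Finset.sum_add_distrib, hgz, ← Finset.sum_mul, ← hδ]
    -- Centring `w` at `c / 2` bounds its modulus by `c / 2`; the centring term disappears on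
    -- summation because both masses are `1`.
    have h3 : ∀ i, (q i - p' i) * w i ≤ c / 2 * |p' i - q i| + c / 2 * (q i - p' i) := by
      intro i
      have e1 : (q i - p' i) * (w i - c / 2) ≤ |q i - p' i| * |w i - c / 2| := by
        rw [← abs_mul]; exact le_abs_self _
      have e2 : |w i - c / 2| ≤ c / 2 := by
        rw [abs_le]
        constructor <;> linarith [hw0 i, hwc i]
      have e3 := mul_le_mul_of_nonneg_left e2 (abs_nonneg (q i - p' i))
      rw [abs_sub_comm (p' i)]
      linarith
    have h4 := Finset.sum_le_sum fun i (_ : i ∈ Finset.univ) => h3 i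
    simp only [sub_mul, Finset.sum_sub_distrib, Finset.sum_add_distrib, ← Finset.mul_sum,
      hq1, hp1] at h4
    have h5 : δ * c ≤ c / 2 * ∑ i, |p' i - q i| := by linarith
    have h6 : c * (2 * δ) ≤ c * ∑ i, |p' i - q i| := by linarith
    exact le_of_mul_le_mul_left h6 hcpos
  refine ⟨⟨p, ⟨hp, hpz⟩, le_antisymm ?_ (hlb ⟨p, ⟨hp, hpz⟩, rfl⟩)⟩, hlb⟩
  simp only
  rw [hvar]
  calc ∑ i, |p i - q i| ≤ ∑ i, ((q i - g i) + if i = i₀ then δ else 0) := by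
        refine Finset.sum_le_sum fun i _ => ?_
        have := sub_nonneg.2 (hgq i)
        simp only [p]
        rw [abs_le]
        split_ifs <;> constructor <;> linarith
    _ = 2 * δ := by
        rw [Finset.sum_add_distrib, Finset.sum_ite_eq', if_pos (Finset.mem_univ _), ← hδ]; ring

/-! ### Greedy evaluation for the variation distance -/

/-- The part of the allowance `θ - z 0` left after the first `j` elements of a sorted row, when
mass is kept greedily. -/
def allowance (z q : ℕ → ℝ) (θ : ℝ) : ℕ → ℝ
  | 0 => θ - z 0
  | j + 1 => if allowance z q θ j < q j * (z j - z 0) then 0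
      else allowance z q θ j - q j * (z j - z 0)

/-- The mass that the greedy rule keeps on element `j`. -/
def keptMass (z q : ℕ → ℝ) (θ : ℝ) (j : ℕ) : ℝ :=
  if allowance z q θ j < q j * (z j - z 0) then allowance z q θ j / (z j - z 0) else q j

namespace SortedRow

variable {S : ℕ} {z q : ℕ → ℝ} {θ : ℝ}

theorem allowance_nonneg (h : SortedRow S z q θ) (j : ℕ) : 0 ≤ allowance z q θ j := by
  induction j with
  | zero => exact sub_nonneg.2 h.first_le
  | succ j ih =>
    rw [allowance]
    split_ifs with hc
    · exact le_rfl
    · linarith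

theorem pos_of_allowance_lt (h : SortedRow S z q θ) {j : ℕ} (hj : j < S)
    (hc : allowance z q θ j < q j * (z j - z 0)) : 0 < z j - z 0 :=
  pos_of_mul_pos_right ((h.allowance_nonneg j).trans_lt hc) (h.weight_pos j hj).le

theorem keptMass_nonneg (h : SortedRow S z q θ) {j : ℕ} (hj : j < S) : 0 ≤ keptMass z q θ j := by
  rw [keptMass]
  split_ifs with hc
  · exact div_nonneg (h.allowance_nonneg j) (h.pos_of_allowance_lt hj hc).le
  · exact (h.weight_pos j hj).le

theorem keptMass_le (h : SortedRow S z q θ) {j : ℕ} (hj : j < S) : keptMass z q θ j ≤ q j := by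
  rw [keptMass]
  split_ifs with hc
  · exact (div_le_iff₀ (h.pos_of_allowance_lt hj hc)).2 hc.le
  · exact le_rfl

theorem sum_keptMass (h : SortedRow S z q θ) {j : ℕ} (hj : j ≤ S) :
    ∑ i ∈ Finset.range j, keptMass z q θ i * (z i - z 0) = θ - z 0 - allowance z q θ j := by
  induction j with
  | zero => simp [allowance]
  | succ j ih =>
    rw [Finset.sum_range_succ, ih (by omega), allowance, keptMass]
    split_ifs with hc
    · rw [div_mul_cancel₀ _ (h.pos_of_allowance_lt (by omega) hc).ne']; ring
    · ring

/-- After the first truncation every later payoff is strictly above `z 0`, so its positive mass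
exceeds a zero allowance and is truncated again. -/
theorem allowance_eq_zero (h : SortedRow S z q θ) {k j : ℕ} (hkj : k < j) (hj : j ≤ S)
    (hc : allowance z q θ k < q k * (z k - z 0)) : allowance z q θ j = 0 := by
  induction j, hkj using Nat.le_induction with
  | base => rw [allowance, if_pos hc]
  | succ j hkj ih =>
    have hp := h.pos_of_allowance_lt (j := k) (by omega) hc
    have hz := h.mono k j (by omega) (by omega)
    have hq := h.weight_pos j (by omega)
    rw [allowance, ih (by omega), if_pos (mul_pos hq (by linarith))]

theorem keptMass_eq_zero (h : SortedRow S z q θ) {k j : ℕ} (hkj : k < j) (hj : j < S)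
    (hc : allowance z q θ k < q k * (z k - z 0)) : keptMass z q θ j = 0 := by
  have hp := h.pos_of_allowance_lt (j := k) (by omega) hc
  have hz := h.mono k j (by omega) (by omega)
  have hq := h.weight_pos j (by omega)
  rw [keptMass, h.allowance_eq_zero hkj hj.le hc, if_pos (mul_pos hq (by linarith)), zero_div]

/-- If nothing is truncated, the nominal row meets the level and the minimum is `0`. Otherwise the
payoff at the first truncated index is the threshold: all mass strictly below is kept and all mass
strictly above is dropped. Ties at the threshold are unrestricted in the general criterion, so their
order is immaterial. -/
theorem isMinDivergence_variation (h : SortedRow S z q θ) :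
    IsMinDivergence variationPhi (fun i : Fin S => z i) (fun i => q i) θ
      (2 * ∑ i ∈ Finset.range S, (q i - keptMass z q θ i)) := by
  have hq1 : ∑ i : Fin S, q i = 1 := by rw [← h.weight_sum, Finset.sum_range]
  by_cases hall : ∀ i < S, ¬ allowance z q θ i < q i * (z i - z 0)
  · have hk : ∀ i < S, keptMass z q θ i = q i := fun i hi => by rw [keptMass, if_neg (hall i hi)]
    have h0 : ∑ i ∈ Finset.range S, (q i - keptMass z q θ i) = 0 :=
      Finset.sum_eq_zero fun i hi => by rw [hk i (Finset.mem_range.1 hi), sub_self]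
    rw [h0, mul_zero]
    refine isMinDivergence_zero (by simp [variationPhi]) (fun t => abs_nonneg _)
      (fun i => h.weight_pos i i.2) hq1 ?_
    have hs := h.sum_keptMass le_rfl
    have h1 : ∑ i ∈ Finset.range S, keptMass z q θ i * (z i - z 0) =
        ∑ i ∈ Finset.range S, q i * z i - z 0 := by
      calc _ = ∑ i ∈ Finset.range S, (q i * z i - q i * z 0) :=
            Finset.sum_congr rfl fun i hi => by rw [hk i (Finset.mem_range.1 hi)]; ring
        _ = _ := by rw [Finset.sum_sub_distrib, ← Finset.sum_mul, h.weight_sum, one_mul]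
    have h2 := h.allowance_nonneg S
    rw [← Finset.sum_range fun i => q i * z i]
    linarith
  · push Not at hall
    classical
    let k := Nat.find hall
    obtain ⟨hkS, hc⟩ := Nat.find_spec hall
    have hlt : ∀ i < k, keptMass z q θ i = q i := fun i hi => by
      have := Nat.find_min hall hi
      rw [keptMass, if_neg fun hc' => this ⟨hi.trans hkS, hc'⟩]
    have hS0 := h.allowance_eq_zero hkS le_rfl hc
    rw [Finset.sum_range]
    refine _root_.isMinDivergence_variation (g := fun i : Fin S => keptMass z q θ i) (t := z k)
      ⟨0, h.size_pos⟩ (fun i => h.weight_pos i i.2) hq1 (fun i => h.mono 0 i (Nat.zero_le _) i.2)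
      (fun i => h.keptMass_nonneg i.2) (fun i => h.keptMass_le i.2) ?_ ?_ ?_ ?_
    · have := h.sum_keptMass le_rfl
      rw [hS0, sub_zero, Finset.sum_range] at this
      exact this
    · exact sub_pos.1 (h.pos_of_allowance_lt hkS hc)
    · intro i hi
      refine hlt i (lt_of_not_ge fun hki => ?_)
      exact absurd (h.mono k i hki i.2) (not_le.2 hi)
    · intro i hi
      refine h.keptMass_eq_zero (lt_of_not_ge fun hki => ?_) i.2 hc
      exact absurd (h.mono i k hki hkS) (not_le.2 hi)

end SortedRow

/-! ### Prefix structure of the `χ²`-scan -/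

/-- The moments `∑ q`, `∑ q * z`, `∑ q * z ^ 2` over the elements that the `χ²`-scan of the first
`j` elements of a sorted row selects. -/
def selectedMoments (z q : ℕ → ℝ) (θ : ℝ) : ℕ → ℝ × ℝ × ℝ
  | 0 => (0, 0, 0)
  | j + 1 =>
    let m := selectedMoments z q θ j
    if 0 < (m.2.1 - θ * m.1) * z j - (m.2.2 - θ * m.2.1) then m
    else (m.1 + q j, m.2.1 + q j * z j, m.2.2 + q j * z j * z j)

/-- The least `χ²`-divergence in terms of the moments of the selected elements. -/
def momentDivergence (θ : ℝ) (m : ℝ × ℝ × ℝ) : ℝ :=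
  if 0 < m.2.1 - θ * m.1 then
    let t := (m.2.2 - θ * m.2.1) / (m.2.1 - θ * m.1)
    (t - θ) / (m.1 * t - m.2.1) - 1
  else 0

/-- The moments of the first `k` elements. -/
def prefixMoments (z q : ℕ → ℝ) (k : ℕ) : ℝ × ℝ × ℝ :=
  (∑ i ∈ Finset.range k, q i, ∑ i ∈ Finset.range k, q i * z i,
    ∑ i ∈ Finset.range k, q i * z i * z i)

/-- The derivative test of the `χ²`-scan. -/
def scanTest (θ : ℝ) (m : ℝ × ℝ × ℝ) (x : ℝ) : ℝ := (m.2.1 - θ * m.1) * x - (m.2.2 - θ * m.2.1)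

/-- For a prefix, the zero in `x` of this sum is the threshold satisfying the root condition of the
`χ²`-criterion. -/
theorem scanTest_prefixMoments (z q : ℕ → ℝ) (θ x : ℝ) (k : ℕ) :
    scanTest θ (prefixMoments z q k) x = ∑ i ∈ Finset.range k, q i * (x - z i) * (z i - θ) := by
  simp only [scanTest, prefixMoments]
  have : ∀ i, q i * (x - z i) * (z i - θ) =
      (q i * z i) * x - θ * (q i) * x - (q i * z i * z i - θ * (q i * z i)) := by
    intro i; ring
  simp only [this, Finset.sum_sub_distrib, ← Finset.mul_sum, ← Finset.sum_mul]
  ring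

namespace SortedRow

variable {S : ℕ} {z q : ℕ → ℝ} {θ : ℝ}

/-- An affine function that is nonpositive at `z (k - 1)` and positive at the no smaller `z k` has
positive slope. For `k = 0` the test is identically zero and cannot be positive. -/
theorem scanTest_slope (h : SortedRow S z q θ) {k : ℕ} (hkS : k < S)
    (hk : k = 0 ∨ scanTest θ (prefixMoments z q k) (z (k - 1)) ≤ 0)
    (hpos : 0 < scanTest θ (prefixMoments z q k) (z k)) :
    0 < (prefixMoments z q k).2.1 - θ * (prefixMoments z q k).1 := by
  rcases hk with rfl | hk
  · simp [scanTest, prefixMoments] at hpos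
  · have hz := h.mono (k - 1) k (by omega) hkS
    simp only [scanTest] at hk hpos
    by_contra hs
    push Not at hs
    have := mul_nonneg_of_nonpos_of_nonpos hs (sub_nonpos.2 hz)
    linarith

/-- Once an element is rejected the moments freeze and the test has positive slope, so all later, no
smaller values are rejected too. Hence the selection is a prefix. -/
theorem exists_prefix (h : SortedRow S z q θ) {j : ℕ} (hj : j ≤ S) :
    ∃ k ≤ j, selectedMoments z q θ j = prefixMoments z q k ∧
      (k = 0 ∨ scanTest θ (prefixMoments z q k) (z (k - 1)) ≤ 0) ∧
      (k = j ∨ 0 < scanTest θ (prefixMoments z q k) (z k)) := by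
  induction j with
  | zero => exact ⟨0, le_rfl, by simp [selectedMoments, prefixMoments], Or.inl rfl, Or.inl rfl⟩
  | succ j ih =>
    obtain ⟨k, hkj, hm, hk, hkj'⟩ := ih (by omega)
    rw [selectedMoments, hm]
    by_cases hc : 0 < scanTest θ (prefixMoments z q k) (z j)
    · refine ⟨k, by omega, if_pos hc, hk, Or.inr ?_⟩
      rcases hkj' with rfl | hpos
      · exact hc
      · exact hpos
    · have hkj2 : k = j := by
        rcases hkj' with h' | hpos
        · exact h'
        · by_contra hne
          have hs := h.scanTest_slope (by omega) hk hpos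
          have hz := h.mono k j hkj (by omega)
          have := mul_le_mul_of_nonneg_left hz hs.le
          simp only [scanTest] at hpos hc
          linarith
      subst hkj2
      refine ⟨k + 1, le_rfl, (if_neg hc).trans ?_, Or.inr ?_, Or.inl rfl⟩
      · simp only [prefixMoments, Finset.sum_range_succ]
      -- The newly added element contributes zero to the test at its own value, so the test there
      -- keeps its sign.
      · rw [scanTest_prefixMoments, Nat.add_sub_cancel, Finset.sum_range_succ, sub_self, mul_zero,
          zero_mul, add_zero, ← scanTest_prefixMoments]
        exact not_lt.1 hc

/-- With positive slope, the zero `t` of the test separates the prefix from the rest, so `(t - z)⁺`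
lives on the prefix and its sums are the stored moments. With nonpositive slope the prefix must be
the whole row, and the slope is the nominal mean minus `θ`: the minimum is `0`. -/
theorem isMinDivergence_chiSquare (h : SortedRow S z q θ) :
    IsMinDivergence chiSquarePhi (fun i : Fin S => z i) (fun i => q i) θ
      (momentDivergence θ (selectedMoments z q θ S)) := by
  have hq1 : ∑ i : Fin S, q i = 1 := by rw [← h.weight_sum, Finset.sum_range]
  obtain ⟨k, hkS, hm, hk, hk'⟩ := h.exists_prefix le_rfl
  rw [hm, momentDivergence]
  split_ifs with hs
  · set m := prefixMoments z q k with hmk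
    set t := (m.2.2 - θ * m.2.1) / (m.2.1 - θ * m.1) with ht
    have htest : ∀ x, scanTest θ m x = (m.2.1 - θ * m.1) * (x - t) := by
      intro x
      rw [scanTest, ht, mul_sub, mul_div_cancel₀ _ hs.ne']
    have hk0 : k ≠ 0 := by
      rintro rfl
      simp [hmk, prefixMoments] at hs
    have hlast : z (k - 1) ≤ t := by
      have := hk.resolve_left hk0
      rw [htest] at this
      have := nonpos_of_mul_nonpos_right this hs
      linarith
    have hlt : ∀ i < k, max 0 (t - z i) = t - z i := fun i hi =>
      max_eq_right (sub_nonneg.2 ((h.mono i (k - 1) (by omega) (by omega)).trans hlast))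
    have hge : ∀ i, k ≤ i → i < S → max 0 (t - z i) = 0 := by
      intro i hki hi
      have hp := hk'.resolve_left (by omega)
      rw [htest] at hp
      have h1 := pos_of_mul_pos_right hp hs.le
      have h2 := h.mono k i hki hi
      exact max_eq_left (by linarith)
    have hsum : ∀ F : ℕ → ℝ, ∑ i : Fin S, q i * max 0 (t - z i) * F i =
        ∑ i ∈ Finset.range k, q i * (t - z i) * F i := by
      intro F
      rw [← Finset.sum_range fun i => q i * max 0 (t - z i) * F i]
      rw [← Finset.sum_subset (Finset.range_subset_range.2 hkS)]
      · exact Finset.sum_congr rfl fun i hi => by rw [hlt i (Finset.mem_range.1 hi)]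
      · intro i hi hi'
        rw [hge i (by simpa using hi') (Finset.mem_range.1 hi), mul_zero, zero_mul]
    have hW : m.1 * t - m.2.1 = ∑ i : Fin S, q i * max 0 (t - z i) := by
      have := hsum fun _ => 1
      simp only [mul_one] at this
      rw [this, hmk]
      simp only [prefixMoments, mul_sub, Finset.sum_sub_distrib, ← Finset.sum_mul]
    refine _root_.isMinDivergence_chiSquare (fun i => h.weight_pos i i.2) hq1 hW ?_ ?_
    -- Positive slope forces a selected value above `θ`; since `z 0 ≤ θ` and selected values are at
    -- most `t`, element `0` contributes positively to `W`.
    · have h1 : ∃ i ∈ Finset.range k, 0 < q i * (z i - θ) := by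
        refine Finset.exists_lt_of_sum_lt (f := fun _ => (0 : ℝ)) ?_
        simpa [mul_sub, Finset.sum_sub_distrib, ← Finset.sum_mul, hmk, prefixMoments,
          mul_comm θ] using hs
      obtain ⟨i, hi, hpos⟩ := h1
      rw [Finset.mem_range] at hi
      have h2 := pos_of_mul_pos_right hpos (h.weight_pos i (by omega)).le
      have h3 := h.first_le
      have h4 := h.mono i (k - 1) (by omega) (by omega)
      rw [hW]
      refine Finset.sum_pos' (fun i _ => mul_nonneg (h.weight_pos i i.2).le (le_max_left _ _))
        ⟨⟨0, h.size_pos⟩, Finset.mem_univ _, mul_pos (h.weight_pos 0 h.size_pos) ?_⟩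
      exact lt_max_of_lt_right (by simp only; linarith)
    · rw [hsum fun i => z i - θ, ← scanTest_prefixMoments, ← hmk, htest, sub_self, mul_zero]
  · have hkS' : k = S := by
      rcases hk' with h' | hp
      · exact h'
      · by_contra hne
        exact hs (h.scanTest_slope (by omega) hk hp)
    subst hkS'
    refine isMinDivergence_zero (by simp [chiSquarePhi]) (fun t => sq_nonneg _)
      (fun i => h.weight_pos i i.2) hq1 ?_
    simp only [prefixMoments, h.weight_sum, mul_one] at hs
    rw [← Finset.sum_range fun i => q i * z i]
    linarith

end SortedRow

/-! ## Merging -/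

/-- The entries of `f` below `n` are sorted by `key` inside every block of length `w`. -/
def BlockSorted (key : ℕ → ℝ) (f : ℕ → ℕ) (w n : ℕ) : Prop :=
  ∀ m i j, m * w ≤ i → i < j → j < (m + 1) * w → j < n → key (f i) ≤ key (f j)

/-- The multiset of the values of `f` on `[i, j)`. -/
def valuesOn (f : ℕ → ℕ) (i j : ℕ) : Multiset ℕ := ∑ x ∈ Finset.Ico i j, {f x}

theorem valuesOn_self (f : ℕ → ℕ) (i : ℕ) : valuesOn f i i = 0 := by simp [valuesOn]

theorem valuesOn_succ (f : ℕ → ℕ) {i j : ℕ} (h : i ≤ j) :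
    valuesOn f i (j + 1) = valuesOn f i j + {f j} := by
  rw [valuesOn, Finset.sum_Ico_succ_top h, valuesOn]

theorem valuesOn_add (f : ℕ → ℕ) {i j k : ℕ} (h : i ≤ j) (h' : j ≤ k) :
    valuesOn f i j + valuesOn f j k = valuesOn f i k :=
  Finset.sum_Ico_consecutive _ h h'

theorem valuesOn_congr {f g : ℕ → ℕ} {i j : ℕ} (h : ∀ x, i ≤ x → x < j → f x = g x) :
    valuesOn f i j = valuesOn g i j :=
  Finset.sum_congr rfl fun x hx => by
    rw [h x (Finset.mem_Ico.1 hx).1 (Finset.mem_Ico.1 hx).2]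

/-- The blocks of length `2 * w` of `f` below `k` have been merged into `g`. -/
structure Merged (key : ℕ → ℝ) (S w : ℕ) (f g : ℕ → ℕ) (k : ℕ) : Prop where
  boundary : (∃ m, k = m * (2 * w)) ∨ k = S
  sorted : BlockSorted key g (2 * w) k
  values : valuesOn g 0 k = valuesOn f 0 k

/-- In the midst of merging `f` on `[lo, pe)` and `[pe, be)` into `g`: the cells below `p` and
from `pe` to `b` have been moved, and cell `k` is the next to be filled. -/
structure Merging (key : ℕ → ℝ) (S w : ℕ) (f g : ℕ → ℕ) (lo k p pe b be : ℕ) : Prop where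
  aligned : ∃ m, lo = m * (2 * w)
  mid : pe = min (lo + w) S
  right_end : be = min (lo + 2 * w) S
  lo_le : lo ≤ p
  p_le : p ≤ pe
  pe_le : pe ≤ b
  b_le : b ≤ be
  count : k + pe = p + b
  sortedLeft : ∀ i j, lo ≤ i → i < j → j < pe → key (f i) ≤ key (f j)
  sortedRight : ∀ i j, pe ≤ i → i < j → j < be → key (f i) ≤ key (f j)
  before : BlockSorted key g (2 * w) lo
  sorted : ∀ i j, lo ≤ i → i < j → j < k → key (g i) ≤ key (g j)
  le_left : ∀ i j, lo ≤ i → i < k → p ≤ j → j < pe → key (g i) ≤ key (f j)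
  le_right : ∀ i j, lo ≤ i → i < k → b ≤ j → j < be → key (g i) ≤ key (f j)
  values : valuesOn g 0 k = valuesOn f 0 p + valuesOn f pe b

namespace Merged

variable {key : ℕ → ℝ} {S w : ℕ} {f g : ℕ → ℕ}

theorem start : Merged key S w f g 0 :=
  ⟨Or.inl ⟨0, by simp⟩, fun m i j _ _ _ h => absurd h (Nat.not_lt_zero j), by
    simp [valuesOn]⟩

/-- The next pair consists of the blocks `2 * m` and `2 * m + 1` of length `w`; clamping at `S`
allows the right one to be short or empty. -/
theorem toMerging {k pe be : ℕ} (h : Merged key S w f g k) (hf : BlockSorted key f w S)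
    (hk : k < S) (hpe : pe = min (k + w) S) (hbe : be = min (pe + w) S) :
    Merging key S w f g k k k pe pe be := by
  obtain ⟨m, hm⟩ := h.boundary.resolve_right hk.ne
  have e1 : (2 * m) * w = k := by rw [hm]; ring
  have e2 : (2 * m + 1) * w = k + w := by rw [add_mul, e1, one_mul]
  have e3 : (2 * m + 1 + 1) * w = k + w + w := by rw [add_mul, e2, one_mul]
  refine ⟨⟨m, hm⟩, hpe, by omega, le_rfl, by omega, le_rfl, by omega, rfl, ?_, ?_, h.sorted, ?_,
    ?_, ?_, ?_⟩
  · intro i j hi hij hj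
    exact hf (2 * m) i j (by omega) hij (by omega) (by omega)
  · intro i j hi hij hj
    exact hf (2 * m + 1) i j (by omega) hij (by omega) (by omega)
  · intro i j h1 h2 h3; omega
  · intro i j h1 h2; omega
  · intro i j h1 h2; omega
  · rw [h.values, valuesOn_self, add_zero]

end Merged

namespace Merging

variable {key : ℕ → ℝ} {S w : ℕ} {f g : ℕ → ℕ} {lo k p pe b be : ℕ}

theorem toMerged (h : Merging key S w f g lo k p pe b be) (hk : be ≤ k) :
    Merged key S w f g k := by
  obtain ⟨hal, hmid, hend, h1, h2, h3, h4, h5, -, -, hb, hs, -, -, hv⟩ := h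
  obtain ⟨m, hm⟩ := hal
  -- The count `k + pe = p + b` with `p ≤ pe` and `b ≤ be ≤ k` forces equality throughout.
  have hp : p = pe := by omega
  have hbb : b = be := by omega
  have hkb : k = be := by omega
  have e1 : (m + 1) * (2 * w) = lo + 2 * w := by rw [hm]; ring
  refine ⟨?_, ?_, ?_⟩
  · by_cases hc : lo + 2 * w ≤ S
    · exact Or.inl ⟨m + 1, by omega⟩
    · exact Or.inr (by omega)
  · intro m' i j hi hij hj hjk
    by_cases hjl : j < lo
    · exact hb m' i j hi hij hj hjl
    · have hmm : m < m' + 1 := Nat.lt_of_mul_lt_mul_right (a := 2 * w) (by omega)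
      have hle : m * (2 * w) ≤ m' * (2 * w) := Nat.mul_le_mul_right _ (by omega)
      exact hs i j (by omega) hij hjk
  · rw [hv, hp, hbb, hkb, valuesOn_add f (Nat.zero_le _) (by omega)]

/-- The moved key is at most everything remaining: on its own side because that side is sorted, and
on the other because of the comparison with its head. The comparison is needed only if that head
exists. -/
theorem takeLeft (h : Merging key S w f g lo k p pe b be) (hp : p < pe)
    (hle : b < be → key (f p) ≤ key (f b)) :
    Merging key S w f (Function.update g k (f p)) lo (k + 1) (p + 1) pe b be := by
  obtain ⟨hal, hmid, hend, h1, h2, h3, h4, h5, hl, hr, hb, hs, hll, hlr, hv⟩ := h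
  have hlok : lo ≤ k := by omega
  have hg : ∀ i, i < k → Function.update g k (f p) i = g i := fun i hi =>
    Function.update_of_ne hi.ne _ _
  refine ⟨hal, hmid, hend, by omega, by omega, h3, h4, by omega, hl, hr, ?_, ?_, ?_, ?_, ?_⟩
  · intro m i j hi hij hj hjl
    rw [hg i (by omega), hg j (by omega)]
    exact hb m i j hi hij hj hjl
  · intro i j hi hij hj
    rw [hg i (by omega)]
    rcases Nat.lt_succ_iff_lt_or_eq.1 hj with hj' | rfl
    · rw [hg j hj']; exact hs i j hi hij hj'
    · rw [Function.update_self]; exact hll i p hi hij le_rfl hp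
  · intro i j hi hik hj hj'
    rcases Nat.lt_succ_iff_lt_or_eq.1 hik with hi' | rfl
    · rw [hg i hi']; exact hll i j hi hi' (by omega) hj'
    · rw [Function.update_self]; exact hl p j h1 (by omega) hj'
  · intro i j hi hik hj hj'
    rcases Nat.lt_succ_iff_lt_or_eq.1 hik with hi' | rfl
    · rw [hg i hi']; exact hlr i j hi hi' hj hj'
    · rw [Function.update_self]
      refine (hle (by omega)).trans ?_
      rcases hj.eq_or_lt with rfl | hlt
      · exact le_rfl
      · exact hr b j h3 hlt hj'
  · rw [valuesOn_succ _ (Nat.zero_le _), valuesOn_succ _ (Nat.zero_le _), Function.update_self,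
      valuesOn_congr fun x _ hx => hg x hx, hv, add_right_comm]

theorem takeRight (h : Merging key S w f g lo k p pe b be) (hb : b < be)
    (hle : p < pe → key (f b) ≤ key (f p)) :
    Merging key S w f (Function.update g k (f b)) lo (k + 1) p pe (b + 1) be := by
  obtain ⟨hal, hmid, hend, h1, h2, h3, h4, h5, hl, hr, hbs, hs, hll, hlr, hv⟩ := h
  have hlok : lo ≤ k := by omega
  have hg : ∀ i, i < k → Function.update g k (f b) i = g i := fun i hi =>
    Function.update_of_ne hi.ne _ _
  refine ⟨hal, hmid, hend, by omega, by omega, by omega, by omega, by omega, hl, hr, ?_, ?_, ?_,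
    ?_, ?_⟩
  · intro m i j hi hij hj hjl
    rw [hg i (by omega), hg j (by omega)]
    exact hbs m i j hi hij hj hjl
  · intro i j hi hij hj
    rw [hg i (by omega)]
    rcases Nat.lt_succ_iff_lt_or_eq.1 hj with hj' | rfl
    · rw [hg j hj']; exact hs i j hi hij hj'
    · rw [Function.update_self]; exact hlr i b hi hij le_rfl hb
  · intro i j hi hik hj hj'
    rcases Nat.lt_succ_iff_lt_or_eq.1 hik with hi' | rfl
    · rw [hg i hi']; exact hll i j hi hi' hj hj'
    · rw [Function.update_self]
      refine (hle (by omega)).trans ?_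
      rcases hj.eq_or_lt with rfl | hlt
      · exact le_rfl
      · exact hl p j h1 hlt hj'
  · intro i j hi hik hj hj'
    rcases Nat.lt_succ_iff_lt_or_eq.1 hik with hi' | rfl
    · rw [hg i hi']; exact hlr i j hi hi' (by omega) hj'
    · rw [Function.update_self]; exact hr b j h3 (by omega) hj'
  · rw [valuesOn_succ _ (Nat.zero_le _), valuesOn_succ _ h3, Function.update_self,
      valuesOn_congr fun x _ hx => hg x hx, hv, add_assoc]

end Merging

namespace RealRAM

/-! ## Sorting

The programs use the natural-number registers `0` (the length `S`), `2` (the constant `1`) and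
`10` to `18`, and the real registers `10` and `11`. The keys are in the real array `4`; the sorted
indices end up in the array `0`, with the array `1` as a buffer. -/

/-- Do nothing. -/
def skip : Program := .instr (.nMove 18 18)

/-- Move the next index of the left block. -/
def takeLeft : Program :=
  block (.nLoad 17 0 12) [.nStore 1 11 17, .nAdd 12 12 2, .nAdd 11 11 2]

/-- Move the next index of the right block. -/
def takeRight : Program :=
  block (.nLoad 17 0 14) [.nStore 1 11 17, .nAdd 14 14 2, .nAdd 11 11 2]

/-- If the current pair of blocks is exhausted, turn to the next one. -/
def openBlocks : Program :=
  .ite (.nLt 11 15) skip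
    (.seq (block (.nMove 12 11) [.nAdd 13 11 10])
      (.seq (.ite (.nLt 0 13) (.instr (.nMove 13 0)) skip)
        (.seq (block (.nMove 14 13) [.nAdd 15 13 10])
          (.ite (.nLt 0 15) (.instr (.nMove 15 0)) skip))))

/-- Move the smaller of the next indices of the two blocks. -/
def mergeStep : Program :=
  .ite (.nLt 12 13)
    (.ite (.nLt 14 15)
      (.seq (block (.nLoad 17 0 12) [.nLoad 18 0 14, .rLoad 10 4 17, .rLoad 11 4 18])
        (.ite (.rLt 11 10) takeRight takeLeft))
      takeLeft)
    takeRight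

/-- Merge all pairs of blocks into the buffer. -/
def mergePass : Program :=
  .seq (block (.nConst 11 0) [.nConst 15 0])
    (.loop (.nLt 11 0) (.seq openBlocks mergeStep))

/-- Copy the buffer back. -/
def copyBack : Program :=
  .seq (.instr (.nConst 16 0))
    (.loop (.nLt 16 0) (block (.nLoad 17 1 16) [.nStore 0 16 17, .nAdd 16 16 2]))

/-- The list of all indices. -/
def initIndices : Program :=
  .seq (.instr (.nConst 16 0))
    (.loop (.nLt 16 0) (block (.nStore 0 16 16) [.nAdd 16 16 2]))

/-- Bottom-up merge sort. -/
def mergeSort : Program :=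
  .seq initIndices
    (.seq (.instr (.nConst 10 1))
      (.loop (.nLt 10 0) (.seq mergePass (.seq copyBack (.instr (.nAdd 10 10 10))))))

/-! ### Correctness and cost of merge sort -/

theorem Runs.instr {i : Instr} {σ : State} {Q : State → Prop} (h : Q (i.apply σ)) :
    Runs (.instr i) σ 1 Q := ⟨1, _, .instr i σ, le_rfl, h⟩

theorem updateArr_self {α : Type} (m : ℕ → ℕ → α) (k i : ℕ) (x : α) :
    updateArr m k i x k = Function.update (m k) i x := by
  simp [updateArr]

theorem runs_skip {σ : State} {Q : State → Prop} (h : Q σ) : Runs skip σ 1 Q := by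
  refine Runs.instr ?_
  simpa [Instr.apply] using h

/-- What the merging loop maintains. -/
def MergeLoop (key : ℕ → ℝ) (S w : ℕ) (f : ℕ → ℕ) (k : ℕ) (σ : State) : Prop :=
  σ.nReg 11 = k ∧ k ≤ S ∧
    ((Merged key S w f (σ.nArr 1) k ∧ σ.nReg 15 ≤ k) ∨
      ∃ lo, Merging key S w f (σ.nArr 1) lo k (σ.nReg 12) (σ.nReg 13) (σ.nReg 14) (σ.nReg 15))

theorem MergeLoop.merged {key : ℕ → ℝ} {S w : ℕ} {f : ℕ → ℕ} {k : ℕ} {σ : State}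
    (h : MergeLoop key S w f k σ) (hk : σ.nReg 15 ≤ k) : Merged key S w f (σ.nArr 1) k := by
  rcases h.2.2 with h' | ⟨lo, h'⟩
  · exact h'.1
  · exact h'.toMerged hk

/-- Register `15` is the end of the current pair, so reaching it means that both blocks are
exhausted. -/
theorem runs_openBlocks {key : ℕ → ℝ} {S w : ℕ} {f : ℕ → ℕ} {k : ℕ} {σ : State} (hw : 0 < w)
    (hS : σ.nReg 0 = S) (hw' : σ.nReg 10 = w) (hf : BlockSorted key f w S)
    (h : MergeLoop key S w f k σ) (hk : k < S) :
    Runs openBlocks σ 9 fun σ' => σ'.nReg 11 = k ∧ k < σ'.nReg 15 ∧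
      ∃ lo, Merging key S w f (σ'.nArr 1) lo k (σ'.nReg 12) (σ'.nReg 13) (σ'.nReg 14)
        (σ'.nReg 15) := by
  have h11 := h.1
  refine Runs.ite (T := 8) (fun hc => ?_) (fun hc => ?_)
  · simp only [Test.Holds, h11] at hc
    refine (runs_skip (Q := fun σ' => σ'.nReg 11 = k ∧ k < σ'.nReg 15 ∧ ∃ lo, Merging key S w f
      (σ'.nArr 1) lo k (σ'.nReg 12) (σ'.nReg 13) (σ'.nReg 14) (σ'.nReg 15)) ?_).mono (by norm_num)
        fun _ _ => id
    refine ⟨h11, hc, ?_⟩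
    rcases h.2.2 with h' | h'
    · omega
    · exact h'
  · simp only [Test.Holds, h11, not_lt] at hc
    have hm := h.merged hc
    refine Runs.seq (T₁ := 2) (T₂ := 6) (Q₁ := fun σ' => σ'.nReg 12 = k ∧ σ'.nReg 13 = k + w)
      (Runs.block ?_) ?_ (by norm_num)
    · simp [Instr.apply, h11, hw']
    rintro σ₁ hF₁ ⟨a1, a2⟩
    refine Runs.seq (T₁ := 2) (T₂ := 4) (Q₁ := fun σ' => σ'.nReg 13 = min (k + w) S)
      (Runs.ite (fun hc => Runs.instr ?_) fun hc => runs_skip ?_) ?_ (by norm_num)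
    · have e0 := hF₁.nReg 0 (by decide)
      simp only [Test.Holds] at hc
      simp [Instr.apply]
      omega
    · have e0 := hF₁.nReg 0 (by decide)
      simp only [Test.Holds] at hc
      omega
    intro σ₂ hF₂ b1
    refine Runs.seq (T₁ := 2) (T₂ := 2) (Q₁ := fun σ' => σ'.nReg 14 = min (k + w) S ∧
      σ'.nReg 15 = min (k + w) S + w) (Runs.block ?_) ?_ (by norm_num)
    · have e1 := hF₁.nReg 10 (by decide)
      have e2 := hF₂.nReg 10 (by decide)
      simp [Instr.apply, b1, e1, e2, hw']
    rintro σ₃ hF₃ ⟨c1, c2⟩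
    refine (Runs.ite (T := 1) (Q := fun σ' => σ'.nReg 15 = min (min (k + w) S + w) S)
      (fun hc => Runs.instr ?_) fun hc => runs_skip ?_).mono le_rfl ?_
    · have e1 := hF₁.nReg 0 (by decide)
      have e2 := hF₂.nReg 0 (by decide)
      have e3 := hF₃.nReg 0 (by decide)
      simp only [Test.Holds] at hc
      simp [Instr.apply]
      omega
    · have e1 := hF₁.nReg 0 (by decide)
      have e2 := hF₂.nReg 0 (by decide)
      have e3 := hF₃.nReg 0 (by decide)
      simp only [Test.Holds] at hc
      omega
    intro σ₄ hF₄ d1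
    have e12 : σ₄.nReg 12 = k := by
      rw [hF₄.nReg 12 (by decide), hF₃.nReg 12 (by decide), hF₂.nReg 12 (by decide), a1]
    have e11 : σ₄.nReg 11 = k := by
      rw [hF₄.nReg 11 (by decide), hF₃.nReg 11 (by decide), hF₂.nReg 11 (by decide),
        hF₁.nReg 11 (by decide), h11]
    have e13 : σ₄.nReg 13 = min (k + w) S := by
      rw [hF₄.nReg 13 (by decide), hF₃.nReg 13 (by decide), b1]
    have e14 : σ₄.nReg 14 = min (k + w) S := by
      rw [hF₄.nReg 14 (by decide), c1]
    have eA : σ₄.nArr 1 = σ.nArr 1 := by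
      rw [hF₄.nArr 1 (by decide), hF₃.nArr 1 (by decide), hF₂.nArr 1 (by decide),
        hF₁.nArr 1 (by decide)]
    refine ⟨e11, by omega, k, ?_⟩
    rw [eA, e12, e13, e14, d1]
    exact hm.toMerging hf hk rfl rfl

theorem runs_mergeStep {key : ℕ → ℝ} {S w : ℕ} {f : ℕ → ℕ} {k lo : ℕ} {σ : State}
    (h2 : σ.nReg 2 = 1) (hkey : σ.rArr 4 = key) (hf : σ.nArr 0 = f) (h11 : σ.nReg 11 = k)
    (hk : k < σ.nReg 15) (hS : k < S)
    (h : Merging key S w f (σ.nArr 1) lo k (σ.nReg 12) (σ.nReg 13) (σ.nReg 14) (σ.nReg 15)) :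
    Runs mergeStep σ 11 (MergeLoop key S w f (k + 1)) := by
  have hL : ∀ σ₁ : State, σ₁.nReg 2 = 1 → σ₁.nArr 0 = f → σ₁.nReg 11 = k → σ₁.nReg 12 < σ₁.nReg 13 →
      (σ₁.nReg 14 < σ₁.nReg 15 → key (f (σ₁.nReg 12)) ≤ key (f (σ₁.nReg 14))) →
      Merging key S w f (σ₁.nArr 1) lo k (σ₁.nReg 12) (σ₁.nReg 13) (σ₁.nReg 14) (σ₁.nReg 15) →
      Runs takeLeft σ₁ 4 (MergeLoop key S w f (k + 1)) := by
    intro σ₁ c1 c2 c3 c4 c5 c6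
    refine Runs.block ?_
    have := c6.takeLeft c4 c5
    simp only [MergeLoop, Instr.apply, List.foldl_cons, List.foldl_nil]
    simp [updateArr_self, c1, c2, c3]
    exact ⟨hS, Or.inr ⟨lo, this⟩⟩
  have hR : ∀ σ₁ : State, σ₁.nReg 2 = 1 → σ₁.nArr 0 = f → σ₁.nReg 11 = k → σ₁.nReg 14 < σ₁.nReg 15 →
      (σ₁.nReg 12 < σ₁.nReg 13 → key (f (σ₁.nReg 14)) ≤ key (f (σ₁.nReg 12))) →
      Merging key S w f (σ₁.nArr 1) lo k (σ₁.nReg 12) (σ₁.nReg 13) (σ₁.nReg 14) (σ₁.nReg 15) →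
      Runs takeRight σ₁ 4 (MergeLoop key S w f (k + 1)) := by
    intro σ₁ c1 c2 c3 c4 c5 c6
    refine Runs.block ?_
    have := c6.takeRight c4 c5
    simp only [MergeLoop, Instr.apply, List.foldl_cons, List.foldl_nil]
    simp [updateArr_self, c1, c2, c3]
    exact ⟨hS, Or.inr ⟨lo, this⟩⟩
  have hcount := h.count
  have hp := h.p_le
  refine Runs.ite (T := 10) (fun hc => ?_) (fun hc => ?_)
  · simp only [Test.Holds] at hc
    refine Runs.ite (T := 9) (fun hc' => ?_) (fun hc' => ?_)
    · simp only [Test.Holds] at hc'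
      refine Runs.seq (T₁ := 4) (T₂ := 5) (Q₁ := fun σ' => σ'.rReg 10 = key (f (σ.nReg 12)) ∧
        σ'.rReg 11 = key (f (σ.nReg 14))) (Runs.block ?_) ?_ (by norm_num)
      · simp [Instr.apply, hkey, hf]
      rintro σ₁ hF ⟨a1, a2⟩
      have e2 := hF.nReg 2 (by decide)
      have e0 := hF.nArr 0 (by decide)
      have e1 := hF.nArr 1 (by decide)
      have e11 := hF.nReg 11 (by decide)
      have e12 := hF.nReg 12 (by decide)
      have e13 := hF.nReg 13 (by decide)
      have e14 := hF.nReg 14 (by decide)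
      have e15 := hF.nReg 15 (by decide)
      refine Runs.ite (T := 4) (fun hc'' => ?_) (fun hc'' => ?_)
      · simp only [Test.Holds, a1, a2] at hc''
        refine hR σ₁ (by omega) (by rw [e0, hf]) (by omega) (by omega) (fun _ => ?_) ?_
        · rw [e12, e14]; exact hc''.le
        · rw [e1, e12, e13, e14, e15]; exact h
      · simp only [Test.Holds, a1, a2, not_lt] at hc''
        refine hL σ₁ (by omega) (by rw [e0, hf]) (by omega) (by omega) (fun _ => ?_) ?_
        · rw [e12, e14]; exact hc''
        · rw [e1, e12, e13, e14, e15]; exact h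
    · simp only [Test.Holds] at hc'
      exact (hL σ h2 hf h11 hc (fun h' => absurd h' hc') h).mono (by norm_num) fun _ _ => id
  · simp only [Test.Holds] at hc
    -- With the left block used up, the count gives `b = k`, which is below the end of the right
    -- block.
    exact (hR σ h2 hf h11 (by omega) (fun h' => absurd h' hc) h).mono (by norm_num) fun _ _ => id

/-- Each iteration fills exactly one cell, whatever the block length. One flat loop of `S`
iterations thus replaces a nested loop over pairs, and the linear cost is immediate. -/
theorem runs_mergePass {S w : ℕ} {σ : State} (hw : 0 < w) (hS : σ.nReg 0 = S)
    (h2 : σ.nReg 2 = 1) (hw' : σ.nReg 10 = w) (hf : BlockSorted (σ.rArr 4) (σ.nArr 0) w S) :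
    Runs mergePass σ (21 * S + 3) fun σ' => BlockSorted (σ.rArr 4) (σ'.nArr 1) (2 * w) S ∧
      valuesOn (σ'.nArr 1) 0 S = valuesOn (σ.nArr 0) 0 S := by
  refine Runs.seq (T₁ := 2) (T₂ := S * (20 + 1) + 1) (Q₁ := fun σ' => σ'.nReg 11 = 0 ∧ σ'.nReg 15 = 0)
    (Runs.block ?_) ?_ (by omega)
  · simp [Instr.apply]
  rintro σ₁ hF₁ ⟨a1, a2⟩
  refine (Runs.loop (MergeLoop (σ.rArr 4) S w (σ.nArr 0)) ?_ ?_ ?_).mono le_rfl ?_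
  · exact ⟨a1, Nat.zero_le _, Or.inl ⟨Merged.start, by omega⟩⟩
  · intro k hk σ₂ hF₂ hI
    have e0 : σ₂.nReg 0 = S := by rw [hF₂.nReg 0 (by decide), hF₁.nReg 0 (by decide), hS]
    have e10 : σ₂.nReg 10 = w := by rw [hF₂.nReg 10 (by decide), hF₁.nReg 10 (by decide), hw']
    have e2 : σ₂.nReg 2 = 1 := by rw [hF₂.nReg 2 (by decide), hF₁.nReg 2 (by decide), h2]
    have ef : σ₂.nArr 0 = σ.nArr 0 := by rw [hF₂.nArr 0 (by decide), hF₁.nArr 0 (by decide)]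
    have ek : σ₂.rArr 4 = σ.rArr 4 := by rw [hF₂.rArr 4 (by decide), hF₁.rArr 4 (by decide)]
    refine ⟨by simp only [Test.Holds]; rw [hI.1, e0]; exact hk, ?_⟩
    refine Runs.seq (runs_openBlocks hw e0 e10 hf hI hk) ?_ (le_refl (9 + 11))
    rintro σ₃ hF₃ ⟨b1, b2, lo, b3⟩
    exact runs_mergeStep (by rw [hF₃.nReg 2 (by decide), e2])
      (by rw [hF₃.rArr 4 (by decide), ek]) (by rw [hF₃.nArr 0 (by decide), ef]) b1 b2 hk b3
  · intro σ₂ hF₂ hI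
    simp only [Test.Holds]
    rw [hI.1, hF₂.nReg 0 (by decide), hF₁.nReg 0 (by decide), hS]
    exact lt_irrefl S
  · intro σ₂ _ hI
    have hm : Merged (σ.rArr 4) S w (σ.nArr 0) (σ₂.nArr 1) S := by
      rcases hI.2.2 with h' | ⟨lo, h'⟩
      · exact h'.1
      · exact h'.toMerged (by have := h'.right_end; omega)
    exact ⟨hm.sorted, hm.values⟩

theorem runs_copyBack {S : ℕ} {σ : State} (hS : σ.nReg 0 = S) (h2 : σ.nReg 2 = 1) :
    Runs copyBack σ (4 * S + 2) fun σ' => ∀ i < S, σ'.nArr 0 i = σ.nArr 1 i := by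
  refine Runs.seq (T₁ := 1) (T₂ := S * (3 + 1) + 1) (Q₁ := fun σ' => σ'.nReg 16 = 0)
    (Runs.instr ?_) ?_ (by omega)
  · simp [Instr.apply]
  intro σ₁ hF₁ a1
  refine (Runs.loop (fun k σ' => σ'.nReg 16 = k ∧ ∀ i < k, σ'.nArr 0 i = σ.nArr 1 i)
    ⟨a1, fun i hi => absurd hi (Nat.not_lt_zero i)⟩ ?_ ?_).mono le_rfl fun _ _ h => h.2
  · rintro k hk σ₂ hF₂ ⟨b1, b2⟩
    have e0 : σ₂.nReg 0 = S := by rw [hF₂.nReg 0 (by decide), hF₁.nReg 0 (by decide), hS]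
    have e2 : σ₂.nReg 2 = 1 := by rw [hF₂.nReg 2 (by decide), hF₁.nReg 2 (by decide), h2]
    have e1 : σ₂.nArr 1 = σ.nArr 1 := by rw [hF₂.nArr 1 (by decide), hF₁.nArr 1 (by decide)]
    refine ⟨by simp only [Test.Holds]; omega, Runs.block ?_⟩
    simp only [Instr.apply, List.foldl_cons, List.foldl_nil]
    simp [updateArr_self, b1, e2, e1]
    intro i hi
    rcases Nat.lt_or_eq_of_le hi with hi' | rfl
    · rw [Function.update_of_ne hi'.ne, b2 i hi']
    · rw [Function.update_self]
  · rintro σ₂ hF₂ ⟨b1, -⟩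
    simp only [Test.Holds]
    rw [b1, hF₂.nReg 0 (by decide), hF₁.nReg 0 (by decide), hS]
    exact lt_irrefl S

theorem runs_initIndices {S : ℕ} {σ : State} (hS : σ.nReg 0 = S) (h2 : σ.nReg 2 = 1) :
    Runs initIndices σ (3 * S + 2) fun σ' => ∀ i < S, σ'.nArr 0 i = i := by
  refine Runs.seq (T₁ := 1) (T₂ := S * (2 + 1) + 1) (Q₁ := fun σ' => σ'.nReg 16 = 0)
    (Runs.instr ?_) ?_ (by omega)
  · simp [Instr.apply]
  intro σ₁ hF₁ a1
  refine (Runs.loop (fun k σ' => σ'.nReg 16 = k ∧ ∀ i < k, σ'.nArr 0 i = i)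
    ⟨a1, fun i hi => absurd hi (Nat.not_lt_zero i)⟩ ?_ ?_).mono le_rfl fun _ _ h => h.2
  · rintro k hk σ₂ hF₂ ⟨b1, b2⟩
    have e0 : σ₂.nReg 0 = S := by rw [hF₂.nReg 0 (by decide), hF₁.nReg 0 (by decide), hS]
    have e2 : σ₂.nReg 2 = 1 := by rw [hF₂.nReg 2 (by decide), hF₁.nReg 2 (by decide), h2]
    refine ⟨by simp only [Test.Holds]; omega, Runs.block ?_⟩
    simp only [Instr.apply, List.foldl_cons, List.foldl_nil]
    simp [updateArr_self, b1, e2]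
    intro i hi
    rcases Nat.lt_or_eq_of_le hi with hi' | rfl
    · rw [Function.update_of_ne hi'.ne, b2 i hi']
    · rw [Function.update_self]
  · rintro σ₂ hF₂ ⟨b1, -⟩
    simp only [Test.Holds]
    rw [b1, hF₂.nReg 0 (by decide), hF₁.nReg 0 (by decide), hS]
    exact lt_irrefl S

/-- The entries of `f` below `S` are a permutation of the indices that sorts `key`. -/
structure SortsIndices (key : ℕ → ℝ) (S : ℕ) (f : ℕ → ℕ) : Prop where
  mono : ∀ i j, i < j → j < S → key (f i) ≤ key (f j)
  values : valuesOn f 0 S = valuesOn id 0 S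

theorem runs_mergeSort {S : ℕ} {σ : State} (hS : σ.nReg 0 = S) (h2 : σ.nReg 2 = 1) :
    Runs mergeSort σ (40 * (S + 1) * (Nat.clog 2 S + 1)) fun σ' =>
      SortsIndices (σ.rArr 4) S (σ'.nArr 0) := by
  refine Runs.seq (T₂ := 1 + (Nat.clog 2 S * (25 * S + 6 + 1) + 1)) (runs_initIndices hS h2) ?_ ?_
  swap
  · generalize Nat.clog 2 S = c
    nlinarith [Nat.zero_le (c * S)]
  intro σ₁ hF₁ a
  refine Runs.seq (T₁ := 1) (Q₁ := fun σ' => σ'.nReg 10 = 1) (Runs.instr ?_) ?_ le_rfl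
  · simp [Instr.apply]
  intro σ₂ hF₂ b
  -- The rank counts the doublings left until the block length reaches `S`. It must be positive only
  -- while the loop test succeeds, so overshooting `S` is harmless.
  let I : ℕ → State → Prop := fun n σ' => 0 < σ'.nReg 10 ∧
    (σ'.nReg 10 < S → ∃ n', n = n' + 1 ∧ S ≤ σ'.nReg 10 * 2 ^ n) ∧
    BlockSorted (σ.rArr 4) (σ'.nArr 0) (σ'.nReg 10) S ∧
    valuesOn (σ'.nArr 0) 0 S = valuesOn id 0 S
  refine (Runs.loop_of_rank I ?_ ?_).mono le_rfl ?_
  · refine ⟨by omega, fun h => ?_, ?_, ?_⟩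
    · have h1 : 1 < S := by omega
      refine ⟨Nat.clog 2 S - 1, ?_, ?_⟩
      · have := Nat.clog_pos one_lt_two h1
        omega
      · rw [b, one_mul]; exact Nat.le_pow_clog one_lt_two S
    · rw [b]
      intro m i j h1 h2 h3 h4
      omega
    · rw [hF₂.nArr 0 (by decide)]
      exact valuesOn_congr fun x _ hx => a x hx
  · rintro n σ₃ hF₃ ⟨i1, i2, i3, i4⟩ hc
    have e0 : σ₃.nReg 0 = S := by
      rw [hF₃.nReg 0 (by decide), hF₂.nReg 0 (by decide), hF₁.nReg 0 (by decide), hS]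
    have e2 : σ₃.nReg 2 = 1 := by
      rw [hF₃.nReg 2 (by decide), hF₂.nReg 2 (by decide), hF₁.nReg 2 (by decide), h2]
    have e4 : σ₃.rArr 4 = σ.rArr 4 := by
      rw [hF₃.rArr 4 (by decide), hF₂.rArr 4 (by decide), hF₁.rArr 4 (by decide)]
    simp only [Test.Holds, e0] at hc
    obtain ⟨n', rfl, hn⟩ := i2 hc
    refine ⟨n', rfl, ?_⟩
    refine Runs.seq (T₂ := 4 * S + 3) (runs_mergePass i1 e0 e2 rfl (by rw [e4]; exact i3)) ?_ (by omega)
    rintro σ₄ hF₄ ⟨c1, c2⟩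
    refine Runs.seq (T₂ := 1) (runs_copyBack (by rw [hF₄.nReg 0 (by decide), e0])
      (by rw [hF₄.nReg 2 (by decide), e2])) ?_ (by omega)
    intro σ₅ hF₅ d
    have e10 : σ₅.nReg 10 = σ₃.nReg 10 := by
      rw [hF₅.nReg 10 (by decide), hF₄.nReg 10 (by decide)]
    refine Runs.instr ?_
    simp only [I, Instr.apply, Function.update_self, e10]
    refine ⟨by omega, fun h => ?_, ?_, ?_⟩
    · have hn' : S ≤ (σ₃.nReg 10 + σ₃.nReg 10) * 2 ^ n' := by rw [pow_succ] at hn; linarith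
      rcases n' with _ | n'
      · rw [pow_zero, mul_one] at hn'; omega
      · exact ⟨n', rfl, hn'⟩
    · rw [← two_mul]
      intro m i j h1 h2 h3 h4
      rw [d i (by omega), d j h4, ← e4]
      exact c1 m i j h1 h2 h3 h4
    · rw [valuesOn_congr fun x _ hx => d x hx, c2, i4]
  · rintro σ₃ hF₃ ⟨hc, n, -, -, i3, i4⟩
    simp only [Test.Holds] at hc
    have e0 : σ₃.nReg 0 = S := by
      rw [hF₃.nReg 0 (by decide), hF₂.nReg 0 (by decide), hF₁.nReg 0 (by decide), hS]
    -- Once the block length is at least `S`, block `0` is the entire list.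
    exact ⟨fun i j h1 h2 => i3 0 i j (by omega) h1 (by omega) h2, i4⟩

/-- Equality of multisets makes `f` a surjection of a finite set onto itself, hence a bijection. -/
theorem SortsIndices.exists_perm {key : ℕ → ℝ} {S : ℕ} {f : ℕ → ℕ} (h : SortsIndices key S f) :
    ∃ π : Equiv.Perm (Fin S), ∀ i : Fin S, f i = π i := by
  have hv : (Multiset.range S).map f = Multiset.range S := by
    have h' := h.values
    simp only [valuesOn, Nat.Ico_zero_eq_range, id, Finset.sum_multiset_singleton] at h'
    simp only [Finset.sum_eq_multiset_sum, Finset.range_val] at h'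
    have e : ((Multiset.range S).map fun x => ({f x} : Multiset ℕ)) =
        (((Multiset.range S).map f).map fun x => ({x} : Multiset ℕ)) := by
      rw [Multiset.map_map]; rfl
    rw [e, Multiset.sum_map_singleton] at h'
    exact h'
  have hlt : ∀ i < S, f i < S := fun i hi => by
    have : f i ∈ (Multiset.range S).map f :=
      Multiset.mem_map_of_mem f (Multiset.mem_range.2 hi)
    rwa [hv, Multiset.mem_range] at this
  let F : Fin S → Fin S := fun i => ⟨f i, hlt i i.2⟩
  have hsurj : Function.Surjective F := by
    intro j
    have : (j : ℕ) ∈ (Multiset.range S).map f := by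
      rw [hv, Multiset.mem_range]; exact j.2
    obtain ⟨i, hi, hij⟩ := Multiset.mem_map.1 this
    exact ⟨⟨i, Multiset.mem_range.1 hi⟩, Fin.ext hij⟩
  exact ⟨Equiv.ofBijective F ⟨Finite.injective_iff_surjective.2 hsurj, hsurj⟩, fun i => rfl⟩

end RealRAM

namespace RealRAM

/-! ## Scanning a sorted row

The row starts at the cell of the real arrays `5` (values) and `6` (probabilities) in the
natural-number register `20`; the level is in the real register `20`, and the least divergence is
added to the real register `21`. -/

/-- The program `P` adds the least divergence of a sorted row in linear time. -/
structure Scans (φ : ℝ → ℝ) (P : Program) (c : ℕ) : Prop where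
  nWrites : ∀ i ∈ P.collect Instr.nWrites, 30 ≤ i
  rWrites : ∀ i ∈ P.collect Instr.rWrites, i = 21 ∨ 30 ≤ i
  nArrWrites : P.collect Instr.nArrWrites = []
  rArrWrites : P.collect Instr.rArrWrites = []
  runs : ∀ (S : ℕ) (σ : State), σ.nReg 0 = S → σ.nReg 2 = 1 →
    SortedRow S (fun i => σ.rArr 5 (σ.nReg 20 + i)) (fun i => σ.rArr 6 (σ.nReg 20 + i))
      (σ.rReg 20) →
    ∃ D, IsMinDivergence φ (fun i : Fin S => σ.rArr 5 (σ.nReg 20 + i))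
        (fun i => σ.rArr 6 (σ.nReg 20 + i)) (σ.rReg 20) D ∧
      Runs P σ (c * (S + 1)) fun σ' => σ'.rReg 21 = σ.rReg 21 + D

/-- The greedy scan for the variation distance. -/
def variationScan : Program :=
  .seq (block (.nConst 30 0) [.rLoad 30 5 20, .rSub 31 20 30])
    (.loop (.nLt 30 0)
      (.seq (block (.nAdd 31 20 30) [.rLoad 32 5 31, .rLoad 33 6 31, .rSub 32 32 30,
          .rMul 34 33 32, .nAdd 30 30 2])
        (.ite (.rLt 31 34)
          (block (.rDiv 34 31 32) [.rSub 33 33 34, .rAdd 33 33 33, .rAdd 21 21 33, .rConst 31 0])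
          (.instr (.rSub 31 31 34)))))

/-- The invariant is the recursion of `allowance` together with the partial sum of removed mass; the
factor `2` is realized by adding removed mass to itself. -/
theorem scans_variationScan : Scans variationPhi variationScan 20 := by
  refine ⟨by decide, by decide, by decide, by decide, ?_⟩
  intro S σ hS h2 hrow
  set z : ℕ → ℝ := fun i => σ.rArr 5 (σ.nReg 20 + i) with hz
  set q : ℕ → ℝ := fun i => σ.rArr 6 (σ.nReg 20 + i) with hq
  set θ := σ.rReg 20 with hθ
  refine ⟨_, hrow.isMinDivergence_variation, ?_⟩
  refine Runs.seq (T₁ := 3) (T₂ := S * (12 + 1) + 1) (Q₁ := fun σ' => σ'.nReg 30 = 0 ∧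
    σ'.rReg 30 = z 0 ∧ σ'.rReg 31 = θ - z 0) (Runs.block ?_) ?_ (by omega)
  · simp [Instr.apply, hz, hθ]
  rintro σ₁ hF₁ ⟨a1, a2, a3⟩
  refine (Runs.loop (fun j σ' => σ'.nReg 30 = j ∧ σ'.rReg 31 = allowance z q θ j ∧
    σ'.rReg 21 = σ.rReg 21 + 2 * ∑ i ∈ Finset.range j, (q i - keptMass z q θ i) ∧
    σ'.rReg 30 = z 0) ⟨a1, by rw [a3, allowance], by simp [hF₁.rReg 21 (by decide)], a2⟩
    ?_ ?_).mono le_rfl fun _ _ h => h.2.2.1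
  · rintro j hj σ₂ hF₂ ⟨b1, b2, b3, b4⟩
    have e0 : σ₂.nReg 0 = S := by rw [hF₂.nReg 0 (by decide), hF₁.nReg 0 (by decide), hS]
    have e2 : σ₂.nReg 2 = 1 := by rw [hF₂.nReg 2 (by decide), hF₁.nReg 2 (by decide), h2]
    have e20 : σ₂.nReg 20 = σ.nReg 20 := by
      rw [hF₂.nReg 20 (by decide), hF₁.nReg 20 (by decide)]
    have e5 : σ₂.rArr 5 = σ.rArr 5 := by rw [hF₂.rArr 5 (by decide), hF₁.rArr 5 (by decide)]
    have e6 : σ₂.rArr 6 = σ.rArr 6 := by rw [hF₂.rArr 6 (by decide), hF₁.rArr 6 (by decide)]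
    refine ⟨by simp only [Test.Holds]; omega, ?_⟩
    refine Runs.seq (T₁ := 6) (T₂ := 6) (Q₁ := fun σ' => σ'.nReg 30 = j + 1 ∧
      σ'.rReg 32 = z j - z 0 ∧ σ'.rReg 33 = q j ∧ σ'.rReg 34 = q j * (z j - z 0))
      (Runs.block ?_) ?_ le_rfl
    · simp [Instr.apply, b1, b4, e2, e20, e5, e6, hz, hq]
    rintro σ₃ hF₃ ⟨c1, c2, c3, c4⟩
    have f31 : σ₃.rReg 31 = allowance z q θ j := by rw [hF₃.rReg 31 (by decide), b2]
    have f21 := (hF₃.rReg 21 (by decide)).trans b3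
    have f30 : σ₃.rReg 30 = z 0 := by rw [hF₃.rReg 30 (by decide), b4]
    refine Runs.ite (T := 5) (fun hc => ?_) (fun hc => ?_)
    · simp only [Test.Holds, f31, c4] at hc
      refine Runs.block ?_
      simp [Instr.apply, c1, c2, c3, f31, f21, f30, Finset.sum_range_succ, allowance, keptMass, hc]
      ring
    · simp only [Test.Holds, f31, c4] at hc
      refine (Runs.instr (Q := fun σ' => σ'.nReg 30 = j + 1 ∧
        σ'.rReg 31 = allowance z q θ (j + 1) ∧
        σ'.rReg 21 = σ.rReg 21 + 2 * ∑ i ∈ Finset.range (j + 1), (q i - keptMass z q θ i) ∧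
        σ'.rReg 30 = z 0) ?_).mono (by norm_num) fun _ _ => id
      simp [Instr.apply, c1, c4, f31, f21, f30, Finset.sum_range_succ, allowance, keptMass, hc]
  · rintro σ₂ hF₂ ⟨b1, -⟩
    simp only [Test.Holds]
    rw [b1, hF₂.nReg 0 (by decide), hF₁.nReg 0 (by decide), hS]
    exact lt_irrefl S

/-- The moment scan for the `χ²`-distance. -/
def chiSquareScan : Program :=
  .seq (block (.nConst 30 0) [.rConst 30 0, .rConst 31 0, .rConst 32 0, .rConst 38 0,
      .rConst 39 1])
    (.seq
      (.loop (.nLt 30 0)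
        (.seq (block (.nAdd 31 20 30) [.rLoad 35 5 31, .rLoad 36 6 31, .rMul 33 20 30,
            .rSub 33 31 33, .rMul 34 20 31, .rSub 34 32 34, .rMul 37 33 35, .rSub 37 37 34,
            .nAdd 30 30 2])
          (.ite (.rLt 38 37)
            (.instr (.nMove 31 31))
            (block (.rAdd 30 30 36) [.rMul 36 36 35, .rAdd 31 31 36, .rMul 36 36 35,
              .rAdd 32 32 36]))))
      (.seq (block (.rMul 33 20 30) [.rSub 33 31 33, .rMul 34 20 31, .rSub 34 32 34])
        (.ite (.rLt 38 33)
          (block (.rDiv 35 34 33) [.rMul 36 30 35, .rSub 36 36 31, .rSub 35 35 20,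
            .rDiv 35 35 36, .rSub 35 35 39, .rAdd 21 21 35])
          (.instr (.nMove 31 31)))))

/-- Three running moments determine the test, so each element costs constant time and the threshold
is formed only once, at the end. -/
theorem scans_chiSquareScan : Scans chiSquarePhi chiSquareScan 40 := by
  refine ⟨by decide, by decide, by decide, by decide, ?_⟩
  intro S σ hS h2 hrow
  set z : ℕ → ℝ := fun i => σ.rArr 5 (σ.nReg 20 + i) with hz
  set q : ℕ → ℝ := fun i => σ.rArr 6 (σ.nReg 20 + i) with hq
  set θ := σ.rReg 20 with hθ
  refine ⟨_, hrow.isMinDivergence_chiSquare, ?_⟩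
  refine Runs.seq (T₁ := 6) (T₂ := (S * (16 + 1) + 1) + 12) (Q₁ := fun σ' => σ'.nReg 30 = 0 ∧
    σ'.rReg 30 = 0 ∧ σ'.rReg 31 = 0 ∧ σ'.rReg 32 = 0 ∧ σ'.rReg 38 = 0 ∧ σ'.rReg 39 = 1)
    (Runs.block ?_) ?_ (by omega)
  · simp [Instr.apply]
  rintro σ₁ hF₁ ⟨a1, a2, a3, a4, a5, a6⟩
  refine Runs.seq (Runs.loop (fun j σ' => σ'.nReg 30 = j ∧
    σ'.rReg 30 = (selectedMoments z q θ j).1 ∧ σ'.rReg 31 = (selectedMoments z q θ j).2.1 ∧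
    σ'.rReg 32 = (selectedMoments z q θ j).2.2) ⟨a1, a2, a3, a4⟩ ?_ ?_) ?_ le_rfl
  · rintro j hj σ₂ hF₂ ⟨b1, b2, b3, b4⟩
    have e0 : σ₂.nReg 0 = S := by rw [hF₂.nReg 0 (by decide), hF₁.nReg 0 (by decide), hS]
    have e2 : σ₂.nReg 2 = 1 := by rw [hF₂.nReg 2 (by decide), hF₁.nReg 2 (by decide), h2]
    have e20 : σ₂.nReg 20 = σ.nReg 20 := by
      rw [hF₂.nReg 20 (by decide), hF₁.nReg 20 (by decide)]
    have e5 : σ₂.rArr 5 = σ.rArr 5 := by rw [hF₂.rArr 5 (by decide), hF₁.rArr 5 (by decide)]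
    have e6 : σ₂.rArr 6 = σ.rArr 6 := by rw [hF₂.rArr 6 (by decide), hF₁.rArr 6 (by decide)]
    have eθ : σ₂.rReg 20 = θ := by rw [hF₂.rReg 20 (by decide), hF₁.rReg 20 (by decide)]
    have e38 : σ₂.rReg 38 = 0 := by rw [hF₂.rReg 38 (by decide), a5]
    refine ⟨by simp only [Test.Holds]; omega, ?_⟩
    set m := selectedMoments z q θ j with hm
    refine Runs.seq (T₁ := 10) (T₂ := 6) (Q₁ := fun σ' => σ'.nReg 30 = j + 1 ∧
      σ'.rReg 35 = z j ∧ σ'.rReg 36 = q j ∧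
      σ'.rReg 37 = (m.2.1 - θ * m.1) * z j - (m.2.2 - θ * m.2.1))
      (Runs.block ?_) ?_ le_rfl
    · simp [Instr.apply, b1, b2, b3, b4, e2, e20, e5, e6, eθ, hz, hq]
    rintro σ₃ hF₃ ⟨c1, c2, c3, c4⟩
    have f30 := (hF₃.rReg 30 (by decide)).trans b2
    have f31 := (hF₃.rReg 31 (by decide)).trans b3
    have f32 := (hF₃.rReg 32 (by decide)).trans b4
    have f38 := (hF₃.rReg 38 (by decide)).trans e38
    refine Runs.ite (T := 5) (fun hc => ?_) (fun hc => ?_)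
    · simp only [Test.Holds, f38, c4] at hc
      have hs : selectedMoments z q θ (j + 1) = m := by rw [selectedMoments]; exact if_pos hc
      rw [hs]
      refine (Runs.instr (Q := fun σ' => σ'.nReg 30 = j + 1 ∧ σ'.rReg 30 = m.1 ∧
        σ'.rReg 31 = m.2.1 ∧ σ'.rReg 32 = m.2.2) ?_).mono (by norm_num) fun _ _ => id
      simp [Instr.apply, c1, f30, f31, f32]
    · simp only [Test.Holds, f38, c4] at hc
      have hs : selectedMoments z q θ (j + 1) =
          (m.1 + q j, m.2.1 + q j * z j, m.2.2 + q j * z j * z j) := by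
        rw [selectedMoments]; exact if_neg hc
      rw [hs]
      refine Runs.block ?_
      simp [Instr.apply, c1, c2, c3, f30, f31, f32]
  · rintro σ₂ hF₂ ⟨b1, -⟩
    simp only [Test.Holds]
    rw [b1, hF₂.nReg 0 (by decide), hF₁.nReg 0 (by decide), hS]
    exact lt_irrefl S
  · rintro σ₂ hF₂ ⟨-, b2, b3, b4⟩
    have eθ : σ₂.rReg 20 = θ := by rw [hF₂.rReg 20 (by decide), hF₁.rReg 20 (by decide)]
    set m := selectedMoments z q θ S with hm
    refine Runs.seq (T₁ := 4) (T₂ := 8) (Q₁ := fun σ' => σ'.rReg 33 = m.2.1 - θ * m.1 ∧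
      σ'.rReg 34 = m.2.2 - θ * m.2.1) (Runs.block ?_) ?_ le_rfl
    · simp [Instr.apply, b2, b3, b4, eθ]
    rintro σ₃ hF₃ ⟨c1, c2⟩
    have f30 := (hF₃.rReg 30 (by decide)).trans b2
    have f31 := (hF₃.rReg 31 (by decide)).trans b3
    have f20 := (hF₃.rReg 20 (by decide)).trans eθ
    have f38 : σ₃.rReg 38 = 0 := by rw [hF₃.rReg 38 (by decide), hF₂.rReg 38 (by decide), a5]
    have f39 : σ₃.rReg 39 = 1 := by rw [hF₃.rReg 39 (by decide), hF₂.rReg 39 (by decide), a6]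
    have f21 : σ₃.rReg 21 = σ.rReg 21 := by
      rw [hF₃.rReg 21 (by decide), hF₂.rReg 21 (by decide), hF₁.rReg 21 (by decide)]
    refine Runs.ite (T := 7) (fun hc => ?_) (fun hc => ?_)
    · simp only [Test.Holds, f38, c1] at hc
      refine Runs.block ?_
      simp only [momentDivergence, if_pos hc]
      simp [Instr.apply, c1, c2, f30, f31, f20, f39, f21]
    · simp only [Test.Holds, f38, c1] at hc
      refine (Runs.instr (Q := fun σ' => σ'.rReg 21 = σ.rReg 21 + momentDivergence θ m) ?_).mono
        (by norm_num) fun _ _ => id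
      simp only [momentDivergence, if_neg hc]
      simp [Instr.apply, f21]

end RealRAM

namespace RealRAM

variable {S A : ℕ} {M : RobustMDP S A} {v : Fin S → ℝ} {ε : ℝ}

/-! ## Preparing the rows of a state

Further natural-number registers: `3` the state, `4` the action, `5` the first cell of the current
row, `6` the first cell of the first row of the state, `7` to `9` scratch. Further real registers:
`3` and `4` the bounds of the bisection, `5` their distance, `6` and `7` scratch, `8` the
constant `1 / 2`. -/

/-- The input and the constants are in place. -/
structure Ready (M : RobustMDP S A) (v : Fin S → ℝ) (ε : ℝ) (σ : State) : Prop where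
  input : M.IsInput v ε σ
  one : σ.nReg 2 = 1
  half : σ.rReg 8 = 1 / 2

theorem Ready.of_frame {P : Program} {σ σ' : State} (h : Ready M v ε σ) (hF : Frame P σ σ')
    (hn : ∀ i ∈ [0, 1, 2], i ∉ P.collect Instr.nWrites)
    (hr : ∀ i ∈ [0, 1, 2, 8], i ∉ P.collect Instr.rWrites)
    (ha : ∀ i ∈ [0, 1, 2], i ∉ P.collect Instr.rArrWrites) : Ready M v ε σ' := by
  have n0 := hF.nReg 0 (hn 0 (by decide))
  have n1 := hF.nReg 1 (hn 1 (by decide))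
  have n2 := hF.nReg 2 (hn 2 (by decide))
  have r0 := hF.rReg 0 (hr 0 (by decide))
  have r1 := hF.rReg 1 (hr 1 (by decide))
  have r2 := hF.rReg 2 (hr 2 (by decide))
  have r8 := hF.rReg 8 (hr 8 (by decide))
  have a0 := hF.rArr 0 (ha 0 (by decide))
  have a1 := hF.rArr 1 (ha 1 (by decide))
  have a2 := hF.rArr 2 (ha 2 (by decide))
  obtain ⟨⟨i1, i2, i3, i4, i5, i6, i7, i8⟩, h1, h2⟩ := h
  exact ⟨⟨n0 ▸ i1, n1 ▸ i2, r0 ▸ i3, r1 ▸ i4, r2 ▸ i5, a0 ▸ i6, a1 ▸ i7, a2 ▸ i8⟩, n2 ▸ h1,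
    r8 ▸ h2⟩

/-- The payoffs of the current row, as sorting keys. -/
def fillKeys : Program :=
  .seq (.instr (.nConst 7 0))
    (.loop (.nLt 7 0)
      (block (.nAdd 8 5 7) [.rLoad 6 2 8, .rLoad 7 0 7, .rMul 7 2 7, .rAdd 6 6 7, .rStore 4 7 6,
        .nAdd 7 7 2]))

/-- Store the current row in sorted order. -/
def gatherRow : Program :=
  .seq (.instr (.nConst 7 0))
    (.loop (.nLt 7 0)
      (block (.nLoad 8 0 7) [.rLoad 6 4 8, .nAdd 9 5 7, .rStore 5 9 6, .nAdd 8 5 8, .rLoad 6 1 8,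
        .rStore 6 9 6, .nAdd 7 7 2]))

/-- Include the extreme payoffs of the current row in the bounds of the bisection. -/
def updateBounds : Program :=
  .seq (block (.rLoad 6 5 5) [.nAdd 8 5 0, .nSub 8 8 2, .rLoad 7 5 8])
    (.ite (.nLt 4 2)
      (block (.rMove 3 6) [.rMove 4 7])
      (.seq (.ite (.rLt 3 6) (.instr (.rMove 3 6)) skip)
        (.ite (.rLt 4 7) (.instr (.rMove 4 7)) skip)))

/-- Prepare the current row and turn to the next one. -/
def prepareRow : Program :=
  .seq fillKeys (.seq mergeSort (.seq gatherRow (.seq updateBounds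
    (block (.nAdd 5 5 0) [.nAdd 4 4 2]))))

/-- Prepare all rows of the current state. -/
def prepareState : Program :=
  .seq (block (.nConst 4 0) [.nMove 6 5]) (.loop (.nLt 4 1) prepareRow)

/-! ### Correctness and cost of the row preparation -/

theorem runs_fillKeys {σ : State} (h : Ready M v ε σ) {s : Fin S} {a : Fin A}
    (hB : σ.nReg 5 = (s * A + a) * S) :
    Runs fillKeys σ (8 * S + 2) fun σ' => ∀ i : Fin S, σ'.rArr 4 i = M.payoff v s a i := by
  refine Runs.seq (T₁ := 1) (T₂ := S * (7 + 1) + 1) (Q₁ := fun σ' => σ'.nReg 7 = 0)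
    (Runs.instr ?_) ?_ (by omega)
  · simp [Instr.apply]
  intro σ₁ hF₁ a1
  have h₁ := h.of_frame hF₁ (by decide) (by decide) (by decide)
  refine (Runs.loop (fun k σ' => σ'.nReg 7 = k ∧ ∀ i : Fin S, (i : ℕ) < k →
    σ'.rArr 4 i = M.payoff v s a i) ⟨a1, fun i hi => absurd hi (Nat.not_lt_zero _)⟩ ?_ ?_).mono
    le_rfl fun _ _ h => fun i => h.2 i i.2
  · rintro k hk σ₂ hF₂ ⟨b1, b2⟩
    have h₂ := h₁.of_frame hF₂ (by decide) (by decide) (by decide)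
    have e5 : σ₂.nReg 5 = (s * A + a) * S := by
      rw [hF₂.nReg 5 (by decide), hF₁.nReg 5 (by decide), hB]
    have er := h₂.input.reward s a ⟨k, hk⟩
    have ev := h₂.input.value ⟨k, hk⟩
    simp only at er ev
    refine ⟨by simp only [Test.Holds]; rw [b1, h₂.input.numStates]; exact hk, Runs.block ?_⟩
    simp only [Instr.apply, List.foldl_cons, List.foldl_nil]
    simp [updateArr_self, b1, h₂.one, e5, h₂.input.discount, er, ev]
    intro i hi
    rcases Nat.lt_or_eq_of_le hi with hi' | hi'
    · rw [Function.update_of_ne hi'.ne, b2 i hi']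
    · obtain rfl : i = ⟨k, hk⟩ := Fin.ext hi'
      simp [RobustMDP.payoff]
  · rintro σ₂ hF₂ ⟨b1, -⟩
    have h₂ := h₁.of_frame hF₂ (by decide) (by decide) (by decide)
    simp only [Test.Holds]
    rw [b1, h₂.input.numStates]
    exact lt_irrefl S

/-- Rows share two arrays and are written in increasing order; the second conclusion keeps the rows
already stored intact. -/
theorem runs_gatherRow {σ : State} (h : Ready M v ε σ) {s : Fin S} {a : Fin A}
    (hB : σ.nReg 5 = (s * A + a) * S) (hkey : ∀ i : Fin S, σ.rArr 4 i = M.payoff v s a i)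
    {π : Equiv.Perm (Fin S)} (hπ : ∀ i : Fin S, σ.nArr 0 i = π i) :
    Runs gatherRow σ (9 * S + 2) fun σ' =>
      (∀ i : Fin S, σ'.rArr 5 ((s * A + a) * S + i) = M.payoff v s a (π i) ∧
        σ'.rArr 6 ((s * A + a) * S + i) = M.nominal s a (π i)) ∧
      ∀ x < (s * A + a) * S, σ'.rArr 5 x = σ.rArr 5 x ∧ σ'.rArr 6 x = σ.rArr 6 x := by
  refine Runs.seq (T₁ := 1) (T₂ := S * (8 + 1) + 1) (Q₁ := fun σ' => σ'.nReg 7 = 0)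
    (Runs.instr ?_) ?_ (by omega)
  · simp [Instr.apply]
  intro σ₁ hF₁ a1
  have h₁ := h.of_frame hF₁ (by decide) (by decide) (by decide)
  set B := (s * A + a) * S with hBdef
  refine (Runs.loop (fun k σ' => σ'.nReg 7 = k ∧ (∀ i : Fin S, (i : ℕ) < k →
      σ'.rArr 5 (B + i) = M.payoff v s a (π i) ∧ σ'.rArr 6 (B + i) = M.nominal s a (π i)) ∧
      ∀ x < B, σ'.rArr 5 x = σ.rArr 5 x ∧ σ'.rArr 6 x = σ.rArr 6 x)
    ⟨a1, fun i hi => absurd hi (Nat.not_lt_zero _), fun x _ => ?_⟩ ?_ ?_).mono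
    le_rfl fun _ _ h => ⟨fun i => h.2.1 i i.2, h.2.2⟩
  · rw [hF₁.rArr 5 (by decide), hF₁.rArr 6 (by decide)]; exact ⟨rfl, rfl⟩
  · rintro k hk σ₂ hF₂ ⟨b1, b2, b3⟩
    have h₂ := h₁.of_frame hF₂ (by decide) (by decide) (by decide)
    have e5 : σ₂.nReg 5 = B := by rw [hF₂.nReg 5 (by decide), hF₁.nReg 5 (by decide), hB]
    have e0 : σ₂.nArr 0 k = π ⟨k, hk⟩ := by
      rw [hF₂.nArr 0 (by decide), hF₁.nArr 0 (by decide)]; exact hπ ⟨k, hk⟩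
    have ek : σ₂.rArr 4 (π ⟨k, hk⟩) = M.payoff v s a (π ⟨k, hk⟩) := by
      rw [hF₂.rArr 4 (by decide), hF₁.rArr 4 (by decide)]; exact hkey _
    have en := h₂.input.nominal s a (π ⟨k, hk⟩)
    rw [← hBdef] at en
    refine ⟨by simp only [Test.Holds]; rw [b1, h₂.input.numStates]; exact hk, Runs.block ?_⟩
    simp only [Instr.apply, List.foldl_cons, List.foldl_nil]
    simp [updateArr_apply, b1, h₂.one, e5, e0, ek, en]
    constructor
    · intro i hi
      rcases Nat.lt_or_eq_of_le hi with hi' | hi'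
      · rw [if_neg hi'.ne, if_neg hi'.ne]
        exact b2 i hi'
      · obtain rfl : i = ⟨k, hk⟩ := Fin.ext hi'
        simp
    · intro x hx
      rw [if_neg (by omega), if_neg (by omega)]
      exact b3 x hx
  · rintro σ₂ hF₂ ⟨b1, -⟩
    have h₂ := h₁.of_frame hF₂ (by decide) (by decide) (by decide)
    simp only [Test.Holds]
    rw [b1, h₂.input.numStates]
    exact lt_irrefl S

/-- The row of the state `s` and the action `a` is stored in sorted order in `z` and `q`. -/
def RowStored (M : RobustMDP S A) (v : Fin S → ℝ) (s : Fin S) (a : Fin A) (z q : ℕ → ℝ) : Prop :=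
  ∃ π : Equiv.Perm (Fin S),
    (∀ i : Fin S, z ((s * A + a) * S + i) = M.payoff v s a (π i) ∧
      q ((s * A + a) * S + i) = M.nominal s a (π i)) ∧
    ∀ i j : ℕ, i ≤ j → j < S → z ((s * A + a) * S + i) ≤ z ((s * A + a) * S + j)

theorem RowStored.congr {s : Fin S} {a : Fin A} {z q z' q' : ℕ → ℝ}
    (h : RowStored M v s a z q)
    (heq : ∀ x < (s * A + a + 1) * S, z' x = z x ∧ q' x = q x) : RowStored M v s a z' q' := by
  obtain ⟨π, h1, h2⟩ := h
  have hx : ∀ i < S, (s * A + a) * S + i < (s * A + a + 1) * S := fun i hi => by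
    rw [Nat.succ_mul]; omega
  refine ⟨π, fun i => ?_, fun i j hij hj => ?_⟩
  · obtain ⟨e1, e2⟩ := heq _ (hx i i.2)
    rw [e1, e2]; exact h1 i
  · rw [(heq _ (hx i (by omega))).1, (heq _ (hx j hj)).1]
    exact h2 i j hij hj

theorem RowStored.first_le {s : Fin S} {a : Fin A} {z q : ℕ → ℝ} (h : RowStored M v s a z q)
    (s' : Fin S) : z ((s * A + a) * S) ≤ M.payoff v s a s' := by
  obtain ⟨π, h1, h2⟩ := h
  have h3 := h2 0 (π.symm s') (Nat.zero_le _) (π.symm s').2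
  rwa [(h1 _).1, Equiv.apply_symm_apply] at h3

theorem RowStored.le_last {s : Fin S} {a : Fin A} {z q : ℕ → ℝ} (h : RowStored M v s a z q)
    (s' : Fin S) : M.payoff v s a s' ≤ z ((s * A + a) * S + (S - 1)) := by
  obtain ⟨π, h1, h2⟩ := h
  have h4 := s'.2
  have h5 := (π.symm s').2
  have h3 := h2 (π.symm s') (S - 1) (by omega) (by omega)
  rwa [(h1 _).1, Equiv.apply_symm_apply] at h3

/-- `lo` is the largest of the least payoffs of the first `j` actions, and `hi` is the largest
of all of their payoffs. -/
structure Bounds (M : RobustMDP S A) (v : Fin S → ℝ) (s : Fin S) (j : ℕ) (lo hi : ℝ) : Prop where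
  le_lo : ∀ a : Fin A, (a : ℕ) < j → ∃ s', M.payoff v s a s' ≤ lo
  lo_mem : ∃ a : Fin A, (∃ s', lo = M.payoff v s a s') ∧ ∀ s', lo ≤ M.payoff v s a s'
  le_hi : ∀ a : Fin A, (a : ℕ) < j → ∀ s', M.payoff v s a s' ≤ hi
  hi_mem : ∃ (a : Fin A) (s' : Fin S), hi = M.payoff v s a s'

/-- The first action initializes both maxima by its own extremes, since no finite default would be
below all payoffs. -/
theorem Bounds.first {s : Fin S} {a : Fin A} {z q : ℕ → ℝ} (h : RowStored M v s a z q)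
    (hj : (a : ℕ) = 0) :
    Bounds M v s 1 (z ((s * A + a) * S)) (z ((s * A + a) * S + (S - 1))) := by
  have hS := s.2
  have hf := h.first_le
  have hl := h.le_last
  obtain ⟨π, h1, h2⟩ := h
  have e1 := (h1 ⟨0, by omega⟩).1
  have e2 := (h1 ⟨S - 1, by omega⟩).1
  simp only [add_zero] at e1 e2
  refine ⟨?_, ⟨a, ⟨_, e1⟩, hf⟩, ?_, ⟨a, _, e2⟩⟩
  · intro b hb
    obtain rfl : b = a := Fin.ext (by omega)
    exact ⟨_, e1.ge⟩
  · intro b hb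
    obtain rfl : b = a := Fin.ext (by omega)
    exact hl

theorem Bounds.next {s : Fin S} {a : Fin A} {z q : ℕ → ℝ} {lo hi : ℝ}
    (h : RowStored M v s a z q) (hb : Bounds M v s a lo hi) :
    Bounds M v s (a + 1) (max lo (z ((s * A + a) * S)))
      (max hi (z ((s * A + a) * S + (S - 1)))) := by
  have hS := s.2
  have hf := h.first_le
  have hl := h.le_last
  obtain ⟨π, h1, h2⟩ := h
  have e1 := (h1 ⟨0, by omega⟩).1
  have e2 := (h1 ⟨S - 1, by omega⟩).1
  simp only [add_zero] at e1 e2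
  refine ⟨?_, ?_, ?_, ?_⟩
  · intro b hb'
    rcases Nat.lt_or_eq_of_le (Nat.lt_succ_iff.1 hb') with h' | h'
    · obtain ⟨s', hs'⟩ := hb.le_lo b h'
      exact ⟨s', hs'.trans (le_max_left _ _)⟩
    · obtain rfl : b = a := Fin.ext h'
      exact ⟨_, e1.ge.trans (le_max_right _ _)⟩
  · rcases le_total lo (z ((s * A + a) * S)) with h' | h'
    · rw [max_eq_right h']; exact ⟨a, ⟨_, e1⟩, hf⟩
    · rw [max_eq_left h']; exact hb.lo_mem
  · intro b hb' s'
    rcases Nat.lt_or_eq_of_le (Nat.lt_succ_iff.1 hb') with h' | h'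
    · exact (hb.le_hi b h' s').trans (le_max_left _ _)
    · obtain rfl : b = a := Fin.ext h'
      exact (hl s').trans (le_max_right _ _)
  · rcases le_total hi (z ((s * A + a) * S + (S - 1))) with h' | h'
    · rw [max_eq_right h']; exact ⟨a, _, e2⟩
    · rw [max_eq_left h']; exact hb.hi_mem

theorem runs_updateBounds {σ : State} (h : Ready M v ε σ) {s : Fin S} {a : Fin A}
    (hB : σ.nReg 5 = (s * A + a) * S) (ha : σ.nReg 4 = a)
    (hrow : RowStored M v s a (σ.rArr 5) (σ.rArr 6))
    (hb : (a : ℕ) ≠ 0 → Bounds M v s a (σ.rReg 3) (σ.rReg 4)) :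
    Runs updateBounds σ 9 fun σ' => Bounds M v s (a + 1) (σ'.rReg 3) (σ'.rReg 4) := by
  have hS := s.2
  set l := σ.rArr 5 ((s * A + a) * S) with hl
  set u := σ.rArr 5 ((s * A + a) * S + (S - 1)) with hu
  refine Runs.seq (T₁ := 4) (T₂ := 5) (Q₁ := fun σ' => σ'.rReg 6 = l ∧ σ'.rReg 7 = u)
    (Runs.block ?_) ?_ le_rfl
  · have e : (s * A + a) * S + S - 1 = (s * A + a) * S + (S - 1) := by omega
    simp [Instr.apply, hB, h.input.numStates, h.one, hl, hu, e]
  rintro σ₁ hF₁ ⟨a1, a2⟩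
  have e4 := (hF₁.nReg 4 (by decide)).trans ha
  have e2 := (hF₁.nReg 2 (by decide)).trans h.one
  have r3 := hF₁.rReg 3 (by decide)
  have r4 := hF₁.rReg 4 (by decide)
  refine Runs.ite (T := 4) (fun hc => ?_) (fun hc => ?_)
  · simp only [Test.Holds, e4, e2] at hc
    have ha0 : (a : ℕ) = 0 := by omega
    refine (Runs.block (Q := fun σ' => Bounds M v s (a + 1) (σ'.rReg 3) (σ'.rReg 4)) ?_).mono
      (by simp) fun _ _ => id
    have := Bounds.first hrow ha0
    simpa [Instr.apply, a1, a2, ha0, hl, hu] using this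
  · simp only [Test.Holds, e4, e2] at hc
    have hb' := Bounds.next hrow (hb (by omega))
    refine Runs.seq (T₁ := 2) (T₂ := 2) (Q₁ := fun σ' => σ'.rReg 3 = max (σ.rReg 3) l)
      (Runs.ite (fun hc => Runs.instr ?_) fun hc => runs_skip ?_) ?_ le_rfl
    · simp only [Test.Holds, r3, a1] at hc
      simp [Instr.apply, a1, max_eq_right hc.le]
    · simp only [Test.Holds, r3, a1, not_lt] at hc
      rw [r3, max_eq_left hc]
    intro σ₂ hF₂ b
    have r4' := (hF₂.rReg 4 (by decide)).trans r4
    have r7' := (hF₂.rReg 7 (by decide)).trans a2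
    refine Runs.ite (fun hc => Runs.instr ?_) fun hc => runs_skip ?_
    · simp only [Test.Holds, r4', r7'] at hc
      have : max (σ.rReg 4) u = u := max_eq_right hc.le
      rw [← hl, ← hu, this] at hb'
      simpa [Instr.apply, b, r7'] using hb'
    · simp only [Test.Holds, r4', r7', not_lt] at hc
      have : max (σ.rReg 4) u = σ.rReg 4 := max_eq_left hc
      rw [← hl, ← hu, this] at hb'
      rwa [b, r4']

theorem runs_prepareRow {σ : State} (h : Ready M v ε σ) {s : Fin S} {a : Fin A}
    (hB : σ.nReg 5 = (s * A + a) * S) (ha : σ.nReg 4 = a)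
    (hb : (a : ℕ) ≠ 0 → Bounds M v s a (σ.rReg 3) (σ.rReg 4)) :
    Runs prepareRow σ (60 * (S + 1) * (Nat.clog 2 S + 1)) fun σ' =>
      σ'.nReg 5 = (s * A + (a + 1)) * S ∧ σ'.nReg 4 = a + 1 ∧
      Bounds M v s (a + 1) (σ'.rReg 3) (σ'.rReg 4) ∧
      RowStored M v s a (σ'.rArr 5) (σ'.rArr 6) ∧
      ∀ x < (s * A + a) * S, σ'.rArr 5 x = σ.rArr 5 x ∧ σ'.rArr 6 x = σ.rArr 6 x := by
  refine Runs.seq (T₂ := 40 * (S + 1) * (Nat.clog 2 S + 1) + ((9 * S + 2) + (9 + 2)))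
    (runs_fillKeys h hB) ?_ ?_
  swap
  · generalize Nat.clog 2 S = c
    nlinarith [Nat.zero_le (c * S)]
  intro σ₁ hF₁ hkey
  have h₁ := h.of_frame hF₁ (by decide) (by decide) (by decide)
  refine Runs.seq (runs_mergeSort h₁.input.numStates h₁.one) ?_ le_rfl
  intro σ₂ hF₂ hsort
  have h₂ := h₁.of_frame hF₂ (by decide) (by decide) (by decide)
  obtain ⟨π, hπ⟩ := hsort.exists_perm
  have hkey₂ : ∀ i : Fin S, σ₂.rArr 4 i = M.payoff v s a i := by
    intro i
    rw [hF₂.rArr 4 (by decide), hkey]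
  have hB₂ : σ₂.nReg 5 = (s * A + a) * S := by
    rw [hF₂.nReg 5 (by decide), hF₁.nReg 5 (by decide), hB]
  refine Runs.seq (runs_gatherRow h₂ hB₂ hkey₂ hπ) ?_ le_rfl
  rintro σ₃ hF₃ ⟨hz, hold⟩
  have h₃ := h₂.of_frame hF₃ (by decide) (by decide) (by decide)
  have hrow : RowStored M v s a (σ₃.rArr 5) (σ₃.rArr 6) := by
    refine ⟨π, hz, fun i j hij hj => ?_⟩
    have e1 := (hz ⟨i, hij.trans_lt hj⟩).1
    have e2 := (hz ⟨j, hj⟩).1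
    simp only at e1 e2
    rw [e1, e2, ← hkey, ← hkey, ← hπ, ← hπ]
    rcases hij.eq_or_lt with rfl | hlt
    · exact le_rfl
    · exact hsort.mono i j hlt hj
  have hB₃ : σ₃.nReg 5 = (s * A + a) * S := (hF₃.nReg 5 (by decide)).trans hB₂
  have ha₃ : σ₃.nReg 4 = a := by
    rw [hF₃.nReg 4 (by decide), hF₂.nReg 4 (by decide), hF₁.nReg 4 (by decide), ha]
  have r3 : σ₃.rReg 3 = σ.rReg 3 := by
    rw [hF₃.rReg 3 (by decide), hF₂.rReg 3 (by decide), hF₁.rReg 3 (by decide)]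
  have r4 : σ₃.rReg 4 = σ.rReg 4 := by
    rw [hF₃.rReg 4 (by decide), hF₂.rReg 4 (by decide), hF₁.rReg 4 (by decide)]
  refine Runs.seq (runs_updateBounds h₃ hB₃ ha₃ hrow (by rw [r3, r4]; exact hb)) ?_ le_rfl
  intro σ₄ hF₄ hb₄
  have h₄ := h₃.of_frame hF₄ (by decide) (by decide) (by decide)
  have hB₄ : σ₄.nReg 5 = (s * A + a) * S := (hF₄.nReg 5 (by decide)).trans hB₃
  have ha₄ : σ₄.nReg 4 = a := (hF₄.nReg 4 (by decide)).trans ha₃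
  have e5 := hF₄.rArr 5 (by decide)
  have e6 := hF₄.rArr 6 (by decide)
  have o5 : ∀ x < (s * A + a) * S, σ₃.rArr 5 x = σ.rArr 5 x ∧ σ₃.rArr 6 x = σ.rArr 6 x := by
    intro x hx
    rw [(hold x hx).1, (hold x hx).2, hF₂.rArr 5 (by decide), hF₂.rArr 6 (by decide),
      hF₁.rArr 5 (by decide), hF₁.rArr 6 (by decide)]
    exact ⟨rfl, rfl⟩
  have eB : (s * A + a) * S + S = (s * A + (a + 1)) * S := by ring
  refine Runs.block ?_
  simp [Instr.apply, hB₄, ha₄, h₄.input.numStates, h₄.one, e5, e6, eB]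
  exact ⟨hb₄, hrow, o5⟩

theorem runs_prepareState {σ : State} (h : Ready M v ε σ) (hA : 0 < A) {s : Fin S}
    (hB : σ.nReg 5 = s * A * S) :
    Runs prepareState σ (70 * A * (S + 1) * (Nat.clog 2 S + 1)) fun σ' =>
      σ'.nReg 5 = (s + 1) * A * S ∧ σ'.nReg 6 = s * A * S ∧
      Bounds M v s A (σ'.rReg 3) (σ'.rReg 4) ∧
      ∀ a, RowStored M v s a (σ'.rArr 5) (σ'.rArr 6) := by
  refine Runs.seq (T₁ := 2) (T₂ := A * (60 * (S + 1) * (Nat.clog 2 S + 1) + 1) + 1)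
    (Q₁ := fun σ' => σ'.nReg 4 = 0 ∧ σ'.nReg 5 = s * A * S ∧ σ'.nReg 6 = s * A * S)
    (Runs.block ?_) ?_ ?_
  · simp [Instr.apply, hB]
  · rintro σ₁ hF₁ ⟨a1, a2, a3⟩
    have h₁ := h.of_frame hF₁ (by decide) (by decide) (by decide)
    -- Before the first row the bound registers hold arbitrary values, so nothing is claimed about
    -- them; `0 < A` makes the claim effective at the end.
    refine (Runs.loop (fun j σ' => σ'.nReg 4 = j ∧ σ'.nReg 5 = (s * A + j) * S ∧
      (j ≠ 0 → Bounds M v s j (σ'.rReg 3) (σ'.rReg 4)) ∧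
      ∀ a : Fin A, (a : ℕ) < j → RowStored M v s a (σ'.rArr 5) (σ'.rArr 6))
      ⟨a1, by rw [a2, add_zero], fun h => absurd rfl h, fun a ha => absurd ha (Nat.not_lt_zero _)⟩
      ?_ ?_).mono le_rfl ?_
    · rintro j hj σ₂ hF₂ ⟨b1, b2, b3, b4⟩
      have h₂ := h₁.of_frame hF₂ (by decide) (by decide) (by decide)
      refine ⟨by simp only [Test.Holds]; rw [b1, h₂.input.numActions]; exact hj, ?_⟩
      refine (runs_prepareRow h₂ (a := ⟨j, hj⟩) b2 b1 b3).mono le_rfl ?_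
      rintro σ₃ - ⟨c1, c2, c3, c4, c5⟩
      refine ⟨c2, c1, fun _ => c3, fun a ha => ?_⟩
      rcases Nat.lt_or_eq_of_le (Nat.lt_succ_iff.1 ha) with h' | h'
      · refine (b4 a h').congr fun x hx => c5 x (hx.trans_le ?_)
        exact Nat.mul_le_mul_right _ (by simp only; omega)
      · obtain rfl : a = ⟨j, hj⟩ := Fin.ext h'
        exact c4
    · rintro σ₂ hF₂ ⟨b1, -⟩
      have h₂ := h₁.of_frame hF₂ (by decide) (by decide) (by decide)
      simp only [Test.Holds]
      rw [b1, h₂.input.numActions]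
      exact lt_irrefl A
    · rintro σ₂ hF₂ ⟨b1, b2, b3, b4⟩
      refine ⟨by rw [b2]; ring, ?_, b3 hA.ne', fun a => b4 a a.2⟩
      rw [hF₂.nReg 6 (by decide), a3]
  · have h1 : 1 ≤ A * (S + 1) * (Nat.clog 2 S + 1) := Nat.mul_pos (Nat.mul_pos hA (by omega)) (by omega)
    have h2 : A ≤ A * (S + 1) * (Nat.clog 2 S + 1) := by
      rw [mul_assoc]; exact Nat.le_mul_of_pos_right _ (Nat.mul_pos (by omega) (by omega))
    have e1 : A * (60 * (S + 1) * (Nat.clog 2 S + 1) + 1) =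
      60 * (A * (S + 1) * (Nat.clog 2 S + 1)) + A := by ring
    have e2 : 70 * A * (S + 1) * (Nat.clog 2 S + 1) =
      70 * (A * (S + 1) * (Nat.clog 2 S + 1)) := by ring
    rw [e1, e2]
    omega

end RealRAM

namespace RealRAM

variable {S A : ℕ} {M : RobustMDP S A} {v : Fin S → ℝ} {ε : ℝ} {φ : ℝ → ℝ} {scan : Program}
  {c : ℕ}

/-! ## Bisection -/

/-- The total of the least divergences of all actions at the level in the real register `20`. -/
def totalDivergence (scan : Program) : Program :=
  .seq (block (.rConst 21 0) [.nMove 20 6, .nConst 4 0])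
    (.loop (.nLt 4 1) (.seq scan (block (.nAdd 20 20 0) [.nAdd 4 4 2])))

/-- Halve the interval between the bounds. -/
def bisectStep (scan : Program) : Program :=
  .seq (block (.rAdd 20 3 4) [.rMul 20 20 8])
    (.seq (totalDivergence scan)
      (.seq (.ite (.rLt 1 21) (.instr (.rMove 3 20)) (.instr (.rMove 4 20)))
        (.instr (.rSub 5 4 3))))

/-- Bisection to the required accuracy. -/
def bisect (scan : Program) : Program :=
  .seq (.instr (.rSub 5 4 3)) (.loop (.rLt 0 5) (bisectStep scan))

/-- Approximate the robust Bellman operator at all states. -/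
def bellmanProgram (scan : Program) : Program :=
  .seq (block (.nConst 2 1) [.rConst 8 (1 / 2), .nConst 3 0, .nConst 5 0])
    (.loop (.nLt 3 0)
      (.seq prepareState (.seq (bisect scan) (block (.rStore 3 3 4) [.nAdd 3 3 2]))))

/-- From here on the scan is a variable program, so its write lists cannot be decided; the register
ranges recorded in `Scans` take their place. -/
theorem Scans.notMem_nWrites (h : Scans φ scan c) {i : ℕ} (hi : i < 30) :
    i ∉ scan.collect Instr.nWrites := fun h' => absurd (h.nWrites i h') (by omega)

theorem Scans.notMem_rWrites (h : Scans φ scan c) {i : ℕ} (hi : i < 30) (hi' : i ≠ 21) :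
    i ∉ scan.collect Instr.rWrites := fun h' => by
  have := h.rWrites i h'
  omega

theorem Scans.frame_nReg (h : Scans φ scan c) {σ σ' : State} (hF : Frame scan σ σ') {i : ℕ}
    (hi : i < 30) : σ'.nReg i = σ.nReg i := hF.nReg i (h.notMem_nWrites hi)

theorem Scans.ready (h : Scans φ scan c) {σ σ' : State} (hF : Frame scan σ σ')
    (hσ : Ready M v ε σ) : Ready M v ε σ' := by
  refine hσ.of_frame hF ?_ ?_ ?_
  · intro i hi
    exact h.notMem_nWrites (by simp at hi; omega)
  · intro i hi
    exact h.notMem_rWrites (by simp at hi; omega) (by simp at hi; omega)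
  · simp [h.rArrWrites]

/-- The registers and arrays that the bisection leaves alone. -/
theorem Scans.frame_bisectStep (h : Scans φ scan c) {σ σ' : State}
    (hF : Frame (bisectStep scan) σ σ') :
    (Ready M v ε σ → Ready M v ε σ') ∧ σ'.nReg 3 = σ.nReg 3 ∧ σ'.nReg 5 = σ.nReg 5 ∧
      σ'.nReg 6 = σ.nReg 6 ∧ ∀ i, σ'.rArr i = σ.rArr i := by
  have hn : ∀ i < 30, i ≠ 4 → i ≠ 20 → i ∉ (bisectStep scan).collect Instr.nWrites := by
    intro i hi h4 h20
    simp [bisectStep, totalDivergence, Program.collect, block, Instr.nWrites,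
      h.notMem_nWrites hi, h4, h20]
  have hr : ∀ i < 20, i ≠ 3 → i ≠ 4 → i ≠ 5 → i ∉ (bisectStep scan).collect Instr.rWrites := by
    intro i hi h3 h4 h5
    simp [bisectStep, totalDivergence, Program.collect, block, Instr.rWrites,
      h.notMem_rWrites (i := i) (by omega) (by omega), h3, h4, h5]
    omega
  have ha : ∀ i, i ∉ (bisectStep scan).collect Instr.rArrWrites := by
    intro i
    simp [bisectStep, totalDivergence, Program.collect, block, Instr.rArrWrites, h.rArrWrites]
  refine ⟨fun hσ => hσ.of_frame hF (fun i hi => ?_) (fun i hi => ?_) (fun i _ => ha i),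
    hF.nReg 3 (hn 3 (by omega) (by omega) (by omega)),
    hF.nReg 5 (hn 5 (by omega) (by omega) (by omega)),
    hF.nReg 6 (hn 6 (by omega) (by omega) (by omega)), fun i => hF.rArr i (ha i)⟩
  · simp at hi
    exact hn i (by omega) (by omega) (by omega)
  · simp at hi
    exact hr i (by omega) (by omega) (by omega) (by omega)

theorem Scans.frame_bisect (h : Scans φ scan c) {σ σ' : State} (hF : Frame (bisect scan) σ σ') :
    (Ready M v ε σ → Ready M v ε σ') ∧ σ'.nReg 3 = σ.nReg 3 ∧ σ'.nReg 5 = σ.nReg 5 ∧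
      ∀ i, σ'.rArr i = σ.rArr i := by
  have hn : ∀ i < 30, i ≠ 4 → i ≠ 20 → i ∉ (bisect scan).collect Instr.nWrites := by
    intro i hi h4 h20
    simp [bisect, bisectStep, totalDivergence, Program.collect, block, Instr.nWrites,
      h.notMem_nWrites hi, h4, h20]
  have hr : ∀ i < 20, i ≠ 3 → i ≠ 4 → i ≠ 5 → i ∉ (bisect scan).collect Instr.rWrites := by
    intro i hi h3 h4 h5
    simp [bisect, bisectStep, totalDivergence, Program.collect, block, Instr.rWrites,
      h.notMem_rWrites (i := i) (by omega) (by omega), h3, h4, h5]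
    omega
  have ha : ∀ i, i ∉ (bisect scan).collect Instr.rArrWrites := by
    intro i
    simp [bisect, bisectStep, totalDivergence, Program.collect, block, Instr.rArrWrites,
      h.rArrWrites]
  refine ⟨fun hσ => hσ.of_frame hF (fun i hi => ?_) (fun i hi => ?_) (fun i _ => ha i),
    hF.nReg 3 (hn 3 (by omega) (by omega) (by omega)),
    hF.nReg 5 (hn 5 (by omega) (by omega) (by omega)), fun i => hF.rArr i (ha i)⟩
  · simp at hi
    exact hn i (by omega) (by omega) (by omega)
  · simp at hi
    exact hr i (by omega) (by omega) (by omega) (by omega)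

theorem RowStored.sortedRow {s : Fin S} {a : Fin A} {z q : ℕ → ℝ} {θ : ℝ}
    (h : RowStored M v s a z q) (hθ : ∃ s', M.payoff v s a s' ≤ θ) :
    SortedRow S (fun i => z ((s * A + a) * S + i)) (fun i => q ((s * A + a) * S + i)) θ := by
  obtain ⟨s', hs'⟩ := hθ
  have hf := (h.first_le s').trans hs'
  obtain ⟨π, h1, h2⟩ := h
  refine ⟨s.pos, h2, fun i hi => ?_, ?_, hf⟩
  · rw [(h1 ⟨i, hi⟩).2]
    exact M.nominal_pos _ _ _
  · rw [Finset.sum_range]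
    simp only [fun i => (h1 i).2]
    rw [Equiv.sum_comp π (fun i => M.nominal s a i)]
    exact (M.nominal_mem s a).2

theorem RowStored.isMinDivergence {s : Fin S} {a : Fin A} {z q : ℕ → ℝ} {θ D : ℝ}
    (h : RowStored M v s a z q)
    (hD : IsMinDivergence φ (fun i : Fin S => z ((s * A + a) * S + i))
      (fun i => q ((s * A + a) * S + i)) θ D) :
    IsMinDivergence φ (M.payoff v s a) (M.nominal s a) θ D := by
  obtain ⟨π, h1, -⟩ := h
  refine IsMinDivergence.of_perm π ?_
  simp only [fun i => (h1 i).1, fun i => (h1 i).2] at hD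
  exact hD

/-- Every level tested lies above some payoff of each row, which is what makes the scan applicable.
-/
theorem runs_totalDivergence (hscan : Scans φ scan c) {σ : State} (h : Ready M v ε σ) {s : Fin S}
    (hB : σ.nReg 6 = s * A * S) (hrow : ∀ a, RowStored M v s a (σ.rArr 5) (σ.rArr 6))
    (hθ : ∀ a, ∃ s', M.payoff v s a s' ≤ σ.rReg 20) :
    Runs (totalDivergence scan) σ (A * (c * (S + 1) + 3) + 4) fun σ' =>
      ∃ D : Fin A → ℝ, (∀ a, IsMinDivergence φ (M.payoff v s a) (M.nominal s a) (σ.rReg 20) (D a)) ∧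
        σ'.rReg 21 = ∑ a, D a ∧ σ'.rReg 20 = σ.rReg 20 ∧ σ'.rReg 3 = σ.rReg 3 ∧
        σ'.rReg 4 = σ.rReg 4 := by
  refine Runs.seq (T₁ := 3) (T₂ := A * (c * (S + 1) + 2 + 1) + 1)
    (Q₁ := fun σ' => σ'.rReg 21 = 0 ∧ σ'.nReg 20 = s * A * S ∧ σ'.nReg 4 = 0)
    (Runs.block ?_) ?_ (le_of_eq (by ring))
  · simp [Instr.apply, hB]
  rintro σ₁ hF₁ ⟨a1, a2, a3⟩
  have h₁ := h.of_frame hF₁ (by decide) (by decide) (by decide)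
  have hnr : ∀ i < 30, i ≠ 21 → i ∉ (Program.seq scan (block (.nAdd 20 20 0) [.nAdd 4 4 2])).collect
      Instr.rWrites := fun i hi hi' => by
    simp [Program.collect, block, Instr.rWrites, hscan.notMem_rWrites hi hi']
  have hnn : ∀ i < 30, i ≠ 4 → i ≠ 20 → i ∉ (Program.seq scan
      (block (.nAdd 20 20 0) [.nAdd 4 4 2])).collect Instr.nWrites := fun i hi h4 h20 => by
    simp [Program.collect, block, Instr.nWrites, hscan.notMem_nWrites hi, h4, h20]
  have hna : ∀ i, i ∉ (Program.seq scan (block (.nAdd 20 20 0) [.nAdd 4 4 2])).collect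
      Instr.rArrWrites := fun i => by
    simp [Program.collect, block, Instr.rArrWrites, hscan.rArrWrites]
  refine (Runs.loop (fun j σ' => σ'.nReg 4 = j ∧ σ'.nReg 20 = (s * A + j) * S ∧
    ∃ D : ℕ → ℝ, (∀ a : Fin A, (a : ℕ) < j →
      IsMinDivergence φ (M.payoff v s a) (M.nominal s a) (σ.rReg 20) (D a)) ∧
      σ'.rReg 21 = ∑ i ∈ Finset.range j, D i) ⟨a3, by rw [a2, add_zero], 0,
        fun a ha => absurd ha (Nat.not_lt_zero _), by rw [a1, Finset.sum_range_zero]⟩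
    ?_ ?_).mono le_rfl ?_
  · rintro j hj σ₂ hF₂ ⟨b1, b2, D, b3, b4⟩
    have h₂ : Ready M v ε σ₂ := by
      refine h₁.of_frame hF₂ (fun i hi => ?_) (fun i hi => ?_) (fun i _ => hna i)
      · simp at hi
        exact hnn i (by omega) (by omega) (by omega)
      · simp at hi
        exact hnr i (by omega) (by omega)
    have e20 : σ₂.rReg 20 = σ.rReg 20 := by
      rw [hF₂.rReg 20 (hnr 20 (by omega) (by omega)), hF₁.rReg 20 (by decide)]
    have e5 : σ₂.rArr 5 = σ.rArr 5 := by rw [hF₂.rArr 5 (hna 5), hF₁.rArr 5 (by decide)]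
    have e6 : σ₂.rArr 6 = σ.rArr 6 := by rw [hF₂.rArr 6 (hna 6), hF₁.rArr 6 (by decide)]
    have hrow' := hrow ⟨j, hj⟩
    have hsr := hrow'.sortedRow (hθ ⟨j, hj⟩)
    obtain ⟨d, hd, hrun⟩ := hscan.runs S σ₂ h₂.input.numStates h₂.one (by
      rw [e5, e6, e20, b2]; exact hsr)
    rw [e5, e6, e20, b2] at hd
    have hd' := hrow'.isMinDivergence hd
    refine ⟨by simp only [Test.Holds]; rw [b1, h₂.input.numActions]; exact hj, ?_⟩
    refine Runs.seq hrun ?_ le_rfl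
    intro σ₃ hF₃ hs
    have h₃ := hscan.ready hF₃ h₂
    have f4 := (hscan.frame_nReg hF₃ (i := 4) (by omega)).trans b1
    have f20 := (hscan.frame_nReg hF₃ (i := 20) (by omega)).trans b2
    have eB : (s * A + j) * S + S = (s * A + (j + 1)) * S := by ring
    -- The family of divergences found so far is extended by the new value at index `j`.
    refine Runs.block ⟨?_, ?_, fun i => if i = j then d else D i, fun a ha => ?_, ?_⟩
    · simp [Instr.apply, f4, h₃.one]
    · simp [Instr.apply, f20, h₃.input.numStates, eB]
    · rcases Nat.lt_or_eq_of_le (Nat.lt_succ_iff.1 ha) with h' | h'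
      · simp only [if_neg h'.ne]
        exact b3 a h'
      · obtain rfl : a = ⟨j, hj⟩ := Fin.ext h'
        simpa using hd'
    · have hsum : ∑ i ∈ Finset.range j, (if i = j then d else D i) = ∑ i ∈ Finset.range j, D i :=
        Finset.sum_congr rfl fun i hi => if_neg (Finset.mem_range.1 hi).ne
      rw [Finset.sum_range_succ, hsum, if_pos rfl]
      simp [Instr.apply, hs, b4]
  · rintro σ₂ hF₂ ⟨b1, -⟩
    have e1 : σ₂.nReg 1 = A := by
      rw [hF₂.nReg 1 (hnn 1 (by omega) (by omega) (by omega)), h₁.input.numActions]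
    simp only [Test.Holds]
    rw [b1, e1]
    exact lt_irrefl A
  · rintro σ₂ hF₂ ⟨-, -, D, b3, b4⟩
    refine ⟨fun a => D a, fun a => b3 a a.2, by rw [b4, Finset.sum_range], ?_, ?_, ?_⟩
    · rw [hF₂.rReg 20 (hnr 20 (by omega) (by omega)), hF₁.rReg 20 (by decide)]
    · rw [hF₂.rReg 3 (hnr 3 (by omega) (by omega)), hF₁.rReg 3 (by decide)]
    · rw [hF₂.rReg 4 (hnr 4 (by omega) (by omega)), hF₁.rReg 4 (by decide)]

/-- The bounds in the real registers `3` and `4` enclose the value at the state `s`. -/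
structure Encloses (M : RobustMDP S A) (φ : ℝ → ℝ) (v : Fin S → ℝ) (s : Fin S) (σ : State) :
    Prop where
  width : σ.rReg 5 = σ.rReg 4 - σ.rReg 3
  le_bellman : σ.rReg 3 ≤ M.bellman φ v s
  bellman_le : M.bellman φ v s ≤ σ.rReg 4
  attained : ∀ a, ∃ s', M.payoff v s a s' ≤ σ.rReg 3

/-- An infeasible midpoint becomes the lower bound and a feasible one the upper. The lower bound
never decreases, so the condition for applying the scans persists. -/
theorem runs_bisectStep (hφ : ConvexOn ℝ Set.univ φ) (hφ1 : φ 1 = 0) (hscan : Scans φ scan c)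
    {σ : State} (h : Ready M v ε σ) (hA : 0 < A) {s : Fin S} (hB : σ.nReg 6 = s * A * S)
    (hrow : ∀ a, RowStored M v s a (σ.rArr 5) (σ.rArr 6)) (he : Encloses M φ v s σ) :
    Runs (bisectStep scan) σ (A * (c * (S + 1) + 3) + 9) fun σ' =>
      Encloses M φ v s σ' ∧ σ'.rReg 5 = σ.rReg 5 / 2 := by
  set θ := (σ.rReg 3 + σ.rReg 4) / 2 with hθ
  have hle : σ.rReg 3 ≤ θ := by linarith [he.le_bellman, he.bellman_le]
  refine Runs.seq (T₁ := 2) (T₂ := (A * (c * (S + 1) + 3) + 4) + (2 + 1))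
    (Q₁ := fun σ' => σ'.rReg 20 = θ) (Runs.block ?_) ?_ (by omega)
  · simp [Instr.apply, h.half, hθ]
    ring
  intro σ₁ hF₁ a
  have h₁ := h.of_frame hF₁ (by decide) (by decide) (by decide)
  have e5 := hF₁.rArr 5 (by decide)
  have e6 := hF₁.rArr 6 (by decide)
  refine Runs.seq (runs_totalDivergence hscan h₁ ((hF₁.nReg 6 (by decide)).trans hB)
    (by rw [e5, e6]; exact hrow) fun a' => ?_) ?_ le_rfl
  · obtain ⟨s', hs'⟩ := he.attained a'
    exact ⟨s', by rw [a]; exact hs'.trans hle⟩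
  rintro σ₂ hF₂ ⟨D, hD, b1, b2, b3, b4⟩
  have r3 : σ₂.rReg 3 = σ.rReg 3 := by rw [b3, hF₁.rReg 3 (by decide)]
  have r4 : σ₂.rReg 4 = σ.rReg 4 := by rw [b4, hF₁.rReg 4 (by decide)]
  have r1 : σ₂.rReg 1 = M.budget := by
    have : 1 ∉ (totalDivergence scan).collect Instr.rWrites := by
      simp [totalDivergence, Program.collect, block, Instr.rWrites,
        hscan.notMem_rWrites (i := 1) (by omega) (by omega)]
    rw [hF₂.rReg 1 this, h₁.input.budget]
  rw [a] at hD b2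
  have hfeas := RobustMDP.feasible_iff hD
  refine Runs.seq (T₁ := 2) (T₂ := 1) (Q₁ := fun σ' => σ'.rReg 4 - σ'.rReg 3 = σ.rReg 5 / 2 ∧
      σ'.rReg 3 ≤ M.bellman φ v s ∧ M.bellman φ v s ≤ σ'.rReg 4 ∧ σ.rReg 3 ≤ σ'.rReg 3)
    (Runs.ite (fun hc => Runs.instr ?_) fun hc => Runs.instr ?_) ?_ le_rfl
  · simp only [Test.Holds, r1, b1] at hc
    have := RobustMDP.le_bellman_of_not_feasible hφ hφ1 (hfeas.not.2 (not_le.2 hc))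
    simp only [Instr.apply]
    simp [b2, r4]
    exact ⟨by rw [he.width, hθ]; ring, this, he.bellman_le, hle⟩
  · simp only [Test.Holds, r1, b1, not_lt] at hc
    have := (hfeas.2 hc).bellman_le hA
    simp only [Instr.apply]
    simp [b2, r3]
    exact ⟨by rw [he.width, hθ]; ring, he.le_bellman, this⟩
  rintro σ₃ - ⟨c1, c2, c3, c4⟩
  refine Runs.instr ⟨⟨?_, ?_, ?_, ?_⟩, ?_⟩
  · simp [Instr.apply]
  · simpa [Instr.apply] using c2
  · simpa [Instr.apply] using c3
  · intro a'
    obtain ⟨s', hs'⟩ := he.attained a'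
    exact ⟨s', by simpa [Instr.apply] using hs'.trans c4⟩
  · simpa [Instr.apply] using c1

theorem runs_bisect (hφ : ConvexOn ℝ Set.univ φ) (hφ1 : φ 1 = 0) (hscan : Scans φ scan c)
    {σ : State} (h : Ready M v ε σ) (hA : 0 < A) {s : Fin S} (hB : σ.nReg 6 = s * A * S)
    (hrow : ∀ a, RowStored M v s a (σ.rArr 5) (σ.rArr 6))
    (hb : Bounds M v s A (σ.rReg 3) (σ.rReg 4)) {R : ℝ}
    (hR : ∀ s a s', |M.payoff v s a s'| ≤ R) {n : ℕ} (hn : 2 * R ≤ ε * 2 ^ n) :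
    Runs (bisect scan) σ (n * (A * (c * (S + 1) + 3) + 10) + 2) fun σ' =>
      |σ'.rReg 4 - M.bellman φ v s| ≤ ε := by
  refine Runs.seq (T₁ := 1) (T₂ := n * (A * (c * (S + 1) + 3) + 9 + 1) + 1)
    (Q₁ := fun σ' => σ'.rReg 5 = σ.rReg 4 - σ.rReg 3) (Runs.instr ?_) ?_ (le_of_eq (by ring))
  · simp [Instr.apply]
  intro σ₁ hF₁ a
  have h₁ := h.of_frame hF₁ (by decide) (by decide) (by decide)
  have r3 := hF₁.rReg 3 (by decide)
  have r4 := hF₁.rReg 4 (by decide)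
  have e5 := hF₁.rArr 5 (by decide)
  have e6 := hF₁.rArr 6 (by decide)
  have n6 := (hF₁.nReg 6 (by decide)).trans hB
  -- The rank bounds the remaining halvings and matters only while the width exceeds `ε`; a width of
  -- at most `ε * 2 ^ 0` already ends the loop.
  refine (Runs.loop_of_rank (fun n σ' => Encloses M φ v s σ' ∧
    (ε < σ'.rReg 5 → ∃ n', n = n' + 1 ∧ σ'.rReg 5 ≤ ε * 2 ^ n)) ⟨⟨?_, ?_, ?_, ?_⟩, ?_⟩ ?_).mono
    le_rfl ?_
  · rw [a, r3, r4]
  · obtain ⟨a', -, ha'⟩ := hb.lo_mem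
    rw [r3]
    exact RobustMDP.le_bellman_of_le_payoff hφ1 a' ha'
  · rw [r4]
    exact (RobustMDP.feasible_of_payoff_le hφ1 fun a' s' => hb.le_hi a' a'.2 s').bellman_le hA
  · intro a'
    rw [r3]
    exact hb.le_lo a' a'.2
  · intro hlt
    have hw : σ₁.rReg 5 ≤ ε * 2 ^ n := by
      refine le_trans ?_ hn
      -- Both initial bounds are payoffs, hence at most `2 * R` apart.
      obtain ⟨a₁, ⟨s₁, hs₁⟩, -⟩ := hb.lo_mem
      obtain ⟨a₂, s₂, hs₂⟩ := hb.hi_mem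
      have q1 := abs_le.1 (hR s a₁ s₁)
      have q2 := abs_le.1 (hR s a₂ s₂)
      rw [a, hs₁, hs₂]
      linarith
    rcases n with _ | n
    · rw [pow_zero, mul_one] at hw
      linarith
    · exact ⟨n, rfl, hw⟩
  · rintro j σ₂ hF₂ ⟨he, hj⟩ hc
    obtain ⟨f1, f2, f3, f4, f5⟩ := hscan.frame_bisectStep (M := M) (v := v) (ε := ε)
      (σ := σ₁) (σ' := σ₂) ⟨hF₂.nReg, hF₂.rReg, hF₂.nArr, hF₂.rArr⟩
    have h₂ := f1 h₁
    simp only [Test.Holds, h₂.input.accuracy] at hc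
    obtain ⟨j', rfl, hw⟩ := hj hc
    refine ⟨j', rfl, (runs_bisectStep hφ hφ1 hscan h₂ hA (f4.trans n6)
      (by rw [f5, f5, e5, e6]; exact hrow) he).mono le_rfl ?_⟩
    rintro σ₃ - ⟨he', hw'⟩
    refine ⟨he', fun hlt => ?_⟩
    have hw2 : σ₃.rReg 5 ≤ ε * 2 ^ j' := by
      rw [hw']
      rw [pow_succ] at hw
      linarith
    rcases j' with _ | j'
    · rw [pow_zero, mul_one] at hw2
      linarith
    · exact ⟨j', rfl, hw2⟩
  · rintro σ₂ hF₂ ⟨hc, j, he, -⟩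
    obtain ⟨f1, -⟩ := hscan.frame_bisectStep (M := M) (v := v) (ε := ε)
      (σ := σ₁) (σ' := σ₂) ⟨hF₂.nReg, hF₂.rReg, hF₂.nArr, hF₂.rArr⟩
    simp only [Test.Holds, (f1 h₁).input.accuracy, not_lt] at hc
    have q1 := he.le_bellman
    have q2 := he.bellman_le
    have q3 := he.width
    rw [abs_le]
    constructor <;> linarith

theorem runs_bellmanProgram (hφ : ConvexOn ℝ Set.univ φ) (hφ1 : φ 1 = 0)
    (hscan : Scans φ scan c) {σ : State} (h : M.IsInput v ε σ) (hS : 0 < S) (hA : 0 < A) {R : ℝ}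
    (hR : ∀ s a s', |M.payoff v s a s'| ≤ R) {n : ℕ} (hn : 2 * R ≤ ε * 2 ^ n) :
    Runs (bellmanProgram scan) σ
      ((100 + c) * (S * A * (S + 1) * (Nat.clog 2 S + 1) * (n + 1))) fun σ' =>
      ∀ s : Fin S, |σ'.rArr 3 s - M.bellman φ v s| ≤ ε := by
  set T := 70 * A * (S + 1) * (Nat.clog 2 S + 1) +
    ((n * (A * (c * (S + 1) + 3) + 10) + 2) + 2) with hT
  refine Runs.seq (T₁ := 4) (T₂ := S * (T + 1) + 1) (Q₁ := fun σ' => Ready M v ε σ' ∧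
    σ'.nReg 3 = 0 ∧ σ'.nReg 5 = 0) (Runs.block ?_) ?_ ?_
  · obtain ⟨i1, i2, i3, i4, i5, i6, i7, i8⟩ := h
    refine ⟨⟨⟨?_, ?_, ?_, ?_, ?_, ?_, ?_, ?_⟩, ?_, ?_⟩, ?_, ?_⟩ <;> simp [Instr.apply, *]
  · rintro σ₁ hF₁ ⟨h₁, a1, a2⟩
    refine (Runs.loop (fun j σ' => Ready M v ε σ' ∧ σ'.nReg 3 = j ∧ σ'.nReg 5 = j * A * S ∧
      ∀ s : Fin S, (s : ℕ) < j → |σ'.rArr 3 s - M.bellman φ v s| ≤ ε)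
      ⟨h₁, a1, by rw [a2]; ring, fun s hs => absurd hs (Nat.not_lt_zero _)⟩ ?_ ?_).mono le_rfl
      fun _ _ h s => h.2.2.2 s s.2
    · rintro j hj σ₂ - ⟨h₂, b1, b2, b3⟩
      refine ⟨by simp only [Test.Holds]; rw [b1, h₂.input.numStates]; exact hj, ?_⟩
      refine Runs.seq (runs_prepareState h₂ hA (s := ⟨j, hj⟩) b2) ?_ hT.ge
      rintro σ₃ hF₃ ⟨c1, c2, c3, c4⟩
      have h₃ := h₂.of_frame hF₃ (by decide) (by decide) (by decide)
      refine Runs.seq (runs_bisect hφ hφ1 hscan h₃ hA c2 c4 c3 hR hn) ?_ le_rfl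
      intro σ₄ hF₄ d
      obtain ⟨f1, f2, f3, f4⟩ := hscan.frame_bisect (M := M) (v := v) (ε := ε) hF₄
      have h₄ := f1 h₃
      have g3 : σ₄.nReg 3 = j := by rw [f2, hF₃.nReg 3 (by decide), b1]
      have g5 : σ₄.nReg 5 = (j + 1) * A * S := by rw [f3, c1]
      have gA : σ₄.rArr 3 = σ₂.rArr 3 := by rw [f4, hF₃.rArr 3 (by decide)]
      refine (Runs.block (σ := σ₄) (i := .rStore 3 3 4) (l := [.nAdd 3 3 2])
        (Q := fun σ' => σ'.nReg 3 = j + 1 ∧ σ'.nReg 5 = (j + 1) * A * S ∧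
          ∀ s : Fin S, (s : ℕ) < j + 1 → |σ'.rArr 3 s - M.bellman φ v s| ≤ ε) ?_).mono le_rfl ?_
      · simp only [Instr.apply, List.foldl_cons, List.foldl_nil]
        simp [updateArr_self, g3, g5, gA, h₄.one]
        intro s hs
        rcases Nat.lt_or_eq_of_le hs with h' | h'
        · rw [Function.update_of_ne h'.ne]
          exact b3 s h'
        · obtain rfl : s = ⟨j, hj⟩ := Fin.ext h'
          simpa using d
      · rintro σ₅ hF₅ ⟨k1, k2, k3⟩
        exact ⟨h₄.of_frame hF₅ (by decide) (by decide) (by decide), k1, k2, k3⟩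
    · rintro σ₂ - ⟨h₂, b1, -⟩
      simp only [Test.Holds]
      rw [b1, h₂.input.numStates]
      exact lt_irrefl S
  -- Per state, preparation costs at most `70 * X` and all halvings at most `n * (c + 13) * X`. The
  -- sum of `log S` and `n` terms is then coarsened to the product in the claim.
  · set X := A * (S + 1) * (Nat.clog 2 S + 1) with hX
    have hX1 : A * (S + 1) ≤ X := Nat.le_mul_of_pos_right _ (by omega)
    have hX2 : A ≤ X := (Nat.le_mul_of_pos_right _ (by omega)).trans hX1
    have hX3 : n * (A * (c * (S + 1) + 3) + 10) ≤ n * ((c + 13) * X) := by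
      refine Nat.mul_le_mul_left _ ?_
      have := Nat.mul_le_mul_left c hX1
      nlinarith
    have hT' : T + 1 ≤ 75 * X + n * ((c + 13) * X) := by
      have : 70 * A * (S + 1) * (Nat.clog 2 S + 1) = 70 * X := by rw [hX]; ring
      omega
    have hSX : 1 ≤ S * X := Nat.mul_pos hS (by omega)
    calc 4 + (S * (T + 1) + 1) ≤ 5 * (S * X) + S * (75 * X + n * ((c + 13) * X)) := by
          have := Nat.mul_le_mul_left S hT'
          omega
      _ = 80 * (S * X) + (c + 13) * (n * (S * X)) := by ring
      _ ≤ (100 + c) * (S * X) + (100 + c) * (n * (S * X)) :=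
          Nat.add_le_add (Nat.mul_le_mul_right _ (by omega)) (Nat.mul_le_mul_right _ (by omega))
      _ = _ := by rw [hX]; ring

end RealRAM

/-! ## The running time -/

theorem convexOn_variationPhi : ConvexOn ℝ Set.univ variationPhi := by
  refine ⟨convex_univ, fun a _ b _ x y hx hy hxy => ?_⟩
  simp only [variationPhi, smul_eq_mul]
  have e : x * a + y * b - 1 = x * (a - 1) + y * (b - 1) := by linear_combination hxy
  calc _ ≤ |x * (a - 1)| + |y * (b - 1)| := by rw [e]; exact abs_add_le _ _
    _ = _ := by rw [abs_mul, abs_mul, abs_of_nonneg hx, abs_of_nonneg hy]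

theorem convexOn_chiSquarePhi : ConvexOn ℝ Set.univ chiSquarePhi := by
  refine ⟨convex_univ, fun a _ b _ x y hx hy hxy => ?_⟩
  simp only [chiSquarePhi, smul_eq_mul]
  obtain rfl : y = 1 - x := by linarith
  nlinarith [mul_nonneg (mul_nonneg hx hy) (sq_nonneg (a - b))]

theorem exists_scan {φ : ℝ → ℝ} (hφ : φ = variationPhi ∨ φ = chiSquarePhi) :
    ConvexOn ℝ Set.univ φ ∧ φ 1 = 0 ∧ ∃ P c, RealRAM.Scans φ P c := by
  rcases hφ with rfl | rfl
  · exact ⟨convexOn_variationPhi, by simp [variationPhi], _, _, RealRAM.scans_variationScan⟩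
  · exact ⟨convexOn_chiSquarePhi, by simp [chiSquarePhi], _, _, RealRAM.scans_chiSquareScan⟩

/-- A number whose predecessor is the logarithm of at most `b * y` is `O(1 + log y)`. -/
theorem le_of_two_pow_pred_le {n : ℕ} {y b : ℝ} (hy : 1 ≤ y) (hb : 0 < b)
    (h : (2 : ℝ) ^ (n - 1) ≤ b * y) : (n : ℝ) ≤ 1 + 2 * (Real.log b + Real.log y) ∨ n = 0 := by
  rcases n with _ | n
  · exact Or.inr rfl
  · left
    rw [Nat.add_sub_cancel] at h
    have h1 := Real.log_le_log (by positivity) h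
    rw [Real.log_pow, Real.log_mul hb.ne' (by positivity)] at h1
    -- Only `1 / 2 ≤ log 2` is needed; this is the source of the factor `2`.
    have h2 := Real.log_two_gt_d9
    have h3 : (0 : ℝ) ≤ n := Nat.cast_nonneg n
    push_cast
    nlinarith

theorem clog_add_one_le {S : ℕ} (hS : 0 < S) :
    ((Nat.clog 2 S + 1 : ℕ) : ℝ) ≤ 2 * (1 + Real.log S) := by
  have hS1 : (1 : ℝ) ≤ S := by exact_mod_cast hS
  have hlog := Real.log_nonneg hS1
  have h : (2 : ℝ) ^ (Nat.clog 2 S - 1) ≤ 1 * S := by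
    rw [one_mul]
    rcases Nat.lt_or_ge 1 S with h1 | h1
    · exact_mod_cast (Nat.pow_pred_clog_lt_self one_lt_two h1).le
    · have : S = 1 := by omega
      subst this
      simp
  push_cast
  rcases le_of_two_pow_pred_le hS1 one_pos h with h' | h'
  · rw [Real.log_one] at h'
    linarith
  · rw [h']
    push_cast
    linarith

/-- `R / ε` may be below `1`, or zero, so it is clamped to `y = max 1 x` before taking logarithms.
With `log 3 ≤ 2`, the count satisfies `n + 1 ≤ 6 + 2 * log y`. -/
theorem exists_halvings {R ε : ℝ} (hR : 0 ≤ R) (hε : 0 < ε) :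
    ∃ n : ℕ, 2 * R ≤ ε * 2 ^ n ∧ ((n + 1 : ℕ) : ℝ) ≤ 6 * (1 + max 0 (Real.log (R / ε))) := by
  set x := R / ε with hx
  have hx0 : 0 ≤ x := div_nonneg hR hε.le
  set y := max 1 x with hy
  have hy1 : 1 ≤ y := le_max_left _ _
  have hyx : x ≤ y := le_max_right _ _
  have hlog : Real.log y ≤ max 0 (Real.log x) := by
    rcases le_total 1 x with h | h
    · rw [hy, max_eq_right h]; exact le_max_right _ _
    · rw [hy, max_eq_left h, Real.log_one]; exact le_max_left _ _
  have hlog0 := Real.log_nonneg hy1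
  refine ⟨Nat.clog 2 ⌈2 * x⌉₊, ?_, ?_⟩
  · have h1 : (⌈2 * x⌉₊ : ℝ) ≤ (2 : ℝ) ^ Nat.clog 2 ⌈2 * x⌉₊ := by
      exact_mod_cast Nat.le_pow_clog one_lt_two _
    have h2 := (Nat.le_ceil (2 * x)).trans h1
    calc 2 * R = ε * (2 * x) := by rw [hx]; field_simp
      _ ≤ _ := mul_le_mul_of_nonneg_left h2 hε.le
  · have h : (2 : ℝ) ^ (Nat.clog 2 ⌈2 * x⌉₊ - 1) ≤ 3 * y := by
      rcases Nat.lt_or_ge 1 ⌈2 * x⌉₊ with h1 | h1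
      · have h2 : (2 : ℝ) ^ (Nat.clog 2 ⌈2 * x⌉₊ - 1) ≤ (⌈2 * x⌉₊ : ℝ) := by
          exact_mod_cast (Nat.pow_pred_clog_lt_self one_lt_two h1).le
        have h3 := Nat.ceil_lt_add_one (a := 2 * x) (by positivity)
        linarith
      · rw [Nat.clog_of_right_le_one h1]
        simp
        linarith
    have h3 : Real.log 3 ≤ 2 := by
      have := Real.log_le_sub_one_of_pos (x := 3) (by norm_num)
      linarith
    push_cast
    rcases le_of_two_pow_pred_le hy1 three_pos h with h' | h'
    · linarith
    · rw [h']
      push_cast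
      linarith

end

theorem mainTheorem12 (φ : ℝ → ℝ) (hφ : φ = variationPhi ∨ φ = chiSquarePhi) :
    ∃ (P : RealRAM.Program) (C : ℝ), 0 < C ∧
      ∀ (S A : ℕ), 0 < S → 0 < A →
      ∀ (M : RobustMDP S A) (v : Fin S → ℝ),
        (∀ s a s', |M.reward s a s' + M.discount * v s'| ≤ M.valueBound) →
      ∀ ε : ℝ, 0 < ε →
      ∀ σ : RealRAM.State, M.IsInput v ε σ →
        ∃ (t : ℕ) (σ' : RealRAM.State), RealRAM.Exec P σ t σ' ∧
          (∀ s : Fin S, |σ'.rArr 3 s - M.bellman φ v s| ≤ ε) ∧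
          (t : ℝ) ≤ C * ((S : ℝ) ^ 2 * (1 + Real.log S) * A *
            (1 + max 0 (Real.log (M.valueBound / ε)))) := by
  obtain ⟨hconv, h1, scan, c, hscan⟩ := exists_scan hφ
  -- The factor `24` is `2 * 2 * 6`, from `S + 1 ≤ 2 * S`, the bound on `Nat.clog 2 S + 1`, and the
  -- bound on `n + 1`.
  refine ⟨RealRAM.bellmanProgram scan, 24 * (100 + c), by positivity, ?_⟩
  intro S A hS hA M v hv ε hε σ hσ
  have hR : 0 ≤ M.valueBound := (abs_nonneg _).trans (hv ⟨0, hS⟩ ⟨0, hA⟩ ⟨0, hS⟩)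
  obtain ⟨n, hn, hn'⟩ := exists_halvings hR hε
  obtain ⟨t, σ', he, ht, hout⟩ := RealRAM.runs_bellmanProgram hconv h1 hscan hσ hS hA hv hn
  refine ⟨t, σ', he, hout, ?_⟩
  have hS1 : (1 : ℝ) ≤ S := by exact_mod_cast hS
  have hL := clog_add_one_le hS
  have hlog := Real.log_nonneg hS1
  set Y := 1 + max 0 (Real.log (M.valueBound / ε)) with hY
  have hY0 : 0 ≤ Y := by
    have := le_max_left 0 (Real.log (M.valueBound / ε))
    rw [hY]
    linarith
  calc (t : ℝ) ≤ (((100 + c) * (S * A * (S + 1) * (Nat.clog 2 S + 1) * (n + 1)) : ℕ) : ℝ) := by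
        exact_mod_cast ht
    _ = (100 + c) * (S * A * (S + 1) * ((Nat.clog 2 S + 1 : ℕ) : ℝ) * ((n + 1 : ℕ) : ℝ)) := by
        push_cast; ring
    _ ≤ (100 + c) * (S * A * (S + S) * (2 * (1 + Real.log S)) * (6 * Y)) := by gcongr
    _ = _ := by ring
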